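/- Let $n\ge 0$ be an integer, let $S_n$ and $A_n$ be the symmetric and alternating groups on $n$ letters, and work over $\mathbb{C}$. Let $\psi(A_n)$ be the permutation representation of $A_n$ on itself by conjugation, let $\psi(A_n)\uparrow_{A_n}^{S_n}$ be the representation of $S_n$ induced from it, and let $\psi(S_n,A_n)$ be the permutation representation of $S_n$ on the set $A_n$ by conjugation. For a representation $V$ of $S_n$ let $\omega(V)=\mathrm{sgn}\otimes V$; $V$ is self-conjugate if $V\cong\omega(V)$. For a finite-dimensional representation with character $\chi$, its Frobenius characteristic is $\mathrm{ch}=\frac1{n!}\sum_{\sigma\in S_n}\chi(\sigma)\,p_{\mathrm{type}(\sigma)}$, where $\mathrm{type}(\sigma)$ is the cycle type of $\sigma$ (a partition of $n$, fixed points included) and $p_\mu=\prod_i p_{\mu_i}$ is the power sum symmetric function. Write $\ell(\mu)$ for the number of parts of a partition $\mu$, and $DO_n$ for the set of partitions of $n$ whose parts are all odd and distinct. Then: 1. $\psi(A_n)\uparrow_{A_n}^{S_n}$ is self-conjugate of degree $n!$. 2. For $n\ge 2$ its Frobenius characteristic is $$2\sum_{\lambda\in DO_n}p_\lambda+\sum_{\substack{\mu\vdash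 n,\ \mu\notin DO_n\\ n-\ell(\mu)\text{ even}}}p_\mu .$$ 3. For $n\ge 2$, $\psi(A_n)\uparrow_{A_n}^{S_n}\cong\psi(S_n,A_n)\oplus\omega(\psi(S_n,A_n))$. 4. For $n\ne 3$, every irreducible representation of $S_n$ occurs in $\psi(A_n)\uparrow_{A_n}^{S_n}$. 5. For $n=3$, $\mathrm{ch}\big(\psi(A_3)\uparrow_{A_3}^{S_3}\big)=3(h_3+e_3)$, where $h_3$ and $e_3$ are the complete homogeneous and elementary symmetric functions of degree 3. -/

import Mathlib

noncomputable section

/-- The permutation representation `ψ(G)` over `ℂ` of a group `G` on itself by conjugation;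
the basis vector of `x` is sent by `g` to the basis vector of `g x g⁻¹`. -/
def conjRep (G : Type*) [Group G] : Representation ℂ G (MonoidAlgebra ℂ G) :=
  (Representation.ofMulAction ℂ (MulAut G) G).comp MulAut.conj

/-- The permutation representation `ψ(G, H)` over `ℂ` of `G` on a normal subgroup `H` by
conjugation; the basis vector of `x` is sent by `g` to the basis vector of `g x g⁻¹`. -/
def conjRepOn {G : Type*} [Group G] (H : Subgroup G) [H.Normal] :
    Representation ℂ G (MonoidAlgebra ℂ H) :=
  (Representation.ofMulAction ℂ (MulAut H) H).comp MulAut.conjNormal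

/-- The sign representation of the symmetric group on `n` letters:
`σ` acts on `ℂ` as multiplication by `sign σ`. -/
def signRep (n : ℕ) : Representation ℂ (Equiv.Perm (Fin n)) ℂ where
  toFun σ := ((Equiv.Perm.sign σ : ℤ) : ℂ) • LinearMap.id
  map_one' := by ext; simp
  map_mul' σ τ := by ext; simp [mul_comm]

/-- The operation `ω` on representations of the symmetric group: tensoring with the sign. -/
def omegaRep {n : ℕ} {V : Type*} [AddCommGroup V] [Module ℂ V]
    (ρ : Representation ℂ (Equiv.Perm (Fin n)) V) :
    Representation ℂ (Equiv.Perm (Fin n)) (TensorProduct ℂ ℂ V) :=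
  (signRep n).tprod ρ

/-- The representation of the symmetric group on `n` letters induced from the conjugation
action of the alternating group on itself. -/
def inducedConjAlternating (n : ℕ) :
    Representation ℂ (Equiv.Perm (Fin n))
      (Representation.IndV (alternatingGroup (Fin n)).subtype
        (conjRep (alternatingGroup (Fin n)))) :=
  Representation.ind (alternatingGroup (Fin n)).subtype (conjRep (alternatingGroup (Fin n)))

namespace SymmFun

/-! Symmetric functions over `ℂ` are written as formal power series in countably many
variables `x₀, x₁, …`, given through their coefficients. -/

open Classical in
/-- The power sum `p_k = ∑ᵢ xᵢ ^ k` (for `k ≥ 1`). -/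
def p (k : ℕ) : MvPowerSeries ℕ ℂ :=
  fun m => if ∃ i, m = Finsupp.single i k then 1 else 0

/-- `p_μ = ∏ᵢ p_{μᵢ}`, the product over all the parts of `μ`, with multiplicity. -/
def pPart {n : ℕ} (μ : n.Partition) : MvPowerSeries ℕ ℂ :=
  (μ.parts.map p).prod

/-- The complete homogeneous symmetric function `h_k`, the sum of all monomials of degree `k`. -/
def h (k : ℕ) : MvPowerSeries ℕ ℂ :=
  fun m => if m.degree = k then 1 else 0

open Classical in
/-- The elementary symmetric function `e_k`, the sum of all squarefree monomials of degree `k`. -/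
def e (k : ℕ) : MvPowerSeries ℕ ℂ :=
  fun m => if m.degree = k ∧ ∀ i, m i ≤ 1 then 1 else 0

/-- The Frobenius characteristic of a (finite-dimensional) representation `ρ` of the symmetric
group, `ch ρ = (1 / n!) ∑_σ χ(σ) p_{type σ}` with `χ` the character of `ρ`. Collecting the
permutations of the same cycle type, this is `∑_{μ ⊢ n} z_μ⁻¹ χ(μ) p_μ`. -/
def ch {n : ℕ} {V : Type*} [AddCommGroup V] [Module ℂ V]
    (ρ : Representation ℂ (Equiv.Perm (Fin n)) V) : MvPowerSeries ℕ ℂ :=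
  ((n.factorial : ℂ)⁻¹) • ∑ σ : Equiv.Perm (Fin n), ρ.character σ • pPart σ.partition

end SymmFun

end

/-!
Inducing a representation of `Aₙ` up to `Sₙ` gives something invariant under `sgn ⊗ ·`, and inducing
the restriction of `ρ` gives `ρ ⊕ sgn ⊗ ρ`. The character of `ψ(Sₙ, Aₙ)` at `σ` counts the even
permutations commuting with `σ`, that is, all of its centralizer if the cycle type of `σ` has odd
distinct parts, and half of it otherwise.

By Frobenius reciprocity, `ρ` occurs as soon as some nonzero vector of `ρ` is fixed by all even
permutations commuting with some even `g`. Such a `g` is found as a product of disjoint cycles of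
odd prime length, the Klein four-group serving for `n = 4`. The key point is that for an odd prime
`p`, a representation of the symmetric group on `p` letters in which no `p`-cycle fixes a nonzero
vector has a nonzero vector fixed by all even permutations fixing some letter. It lies in a hook
representation. To find one, fix a letter `a` and let `m_A(g)` be the principal minor of the
permutation matrix of `g` on a set `A`. The alternating sum of the `m_A(g)` over the sets `A`
containing `a` is nonzero if and only if `g` is a `p`-cycle. If every `∑ g, m_A(g) ρ(g)` vanished,
so would the sum of `ρ(g)` over the `p`-cycles `g`, but this sum is a nonzero scalar.
-/

open Equiv Equiv.Perm Finset

section Twists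

variable {k G V : Type*} [CommRing k] [Monoid G] [AddCommGroup V] [Module k V]

/-- The twist of a representation by a character with values in `{1, -1}`; for the sign character
of a symmetric group this is `sgn ⊗ ρ`. -/
def twistRep (χ : G →* ℤˣ) (ρ : Representation k G V) : Representation k G V where
  toFun g := (χ g : ℤ) • ρ g
  map_one' := by simp
  map_mul' g h := by rw [map_mul, map_mul, Units.val_mul, smul_mul_smul_comm]

theorem twistRep_apply (χ : G →* ℤˣ) (ρ : Representation k G V) (g : G) (v : V) :
    twistRep χ ρ g v = (χ g : ℤ) • ρ g v := rfl

theorem coe_zsmul_coe_zsmul (ε : ℤˣ) (v : V) : (ε : ℤ) • (ε : ℤ) • v = v := by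
  rw [smul_smul, ← Units.val_mul, Int.units_mul_self, Units.val_one, one_smul]

end Twists

section Induction

open Representation TensorProduct

variable {k G H A W : Type*} [CommRing k] [Group G] [Group H] {φ : G →* H}
  [AddCommGroup A] [Module k A] {ρ : Representation k G A} [AddCommGroup W] [Module k W]

theorem indMk_mul (g : G) (h : H) (a : A) :
    IndV.mk φ ρ (φ g * h) (ρ g a) = IndV.mk φ ρ h a := by
  simpa using Coinvariants.mk_self_apply (Representation.tprod ((leftRegular k H).comp φ) ρ) g
    (MonoidAlgebra.single h 1 ⊗ₜ a)

/-- The linear map out of an induced representation given on the generators `h ⊗ a` by a family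
of maps compatible with the relations `φ(g) h ⊗ g a = h ⊗ a`. -/
noncomputable def indLift (f : H → A →ₗ[k] W) (hf : ∀ g h a, f (φ g * h) (ρ g a) = f h a) :
    IndV φ ρ →ₗ[k] W :=
  Coinvariants.lift _ (TensorProduct.lift (Finsupp.linearCombination k f ∘ₗ
    (MonoidAlgebra.coeffLinearEquiv k).toLinearMap)) fun g ↦ by
      ext h a
      simp [hf]

theorem indLift_mk (f : H → A →ₗ[k] W) (hf : ∀ g h a, f (φ g * h) (ρ g a) = f h a) (h : H)
    (a : A) : indLift f hf (IndV.mk φ ρ h a) = f h a := by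
  simp [indLift]

theorem ind_linearMap_ext {f g : IndV φ ρ →ₗ[k] W}
    (hfg : ∀ h a, f (IndV.mk φ ρ h a) = g (IndV.mk φ ρ h a)) : f = g :=
  IndV.hom_ext _ _ fun h ↦ LinearMap.ext (hfg h)

/-- Along a right transversal `T` of `S`, the representation induced from `S` is a direct sum of
copies of the original one. -/
noncomputable def indEquivFinsupp {S : Subgroup H} {T : Set H}
    (hT : Subgroup.IsComplement (S : Set H) T) (σ : Representation k S A) :
    IndV S.subtype σ ≃ₗ[k] T →₀ A :=
  LinearEquiv.ofLinearMap
    (indLift (fun h ↦ Finsupp.lsingle (hT.equiv h).2 ∘ₗ σ (hT.equiv h).1⁻¹) fun g h a ↦ by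
      simp only [LinearMap.comp_apply, Subgroup.subtype_apply, hT.equiv_mul_left, mul_inv_rev,
        map_mul, Module.End.mul_apply, inv_self_apply])
    (Finsupp.lsum k fun t : T ↦ IndV.mk S.subtype σ t)
    (Finsupp.lhom_ext fun t a ↦ by
      have ht : hT.equiv (t : H) = (1, t) := by
        rw [← hT.equiv.eq_symm_apply, hT.equiv_symm_apply, Subgroup.coe_one, one_mul]
      rw [LinearMap.comp_apply, Finsupp.lsum_single, indLift_mk, LinearMap.comp_apply, ht, inv_one,
        map_one, Module.End.one_apply, Finsupp.lsingle_apply, LinearMap.id_apply])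
    (ind_linearMap_ext fun h a ↦ by
      have hmk := indMk_mul (φ := S.subtype) (ρ := σ) (hT.equiv h).1 (hT.equiv h).2
        (σ (hT.equiv h).1⁻¹ a)
      rw [Subgroup.subtype_apply, hT.equiv_fst_mul_equiv_snd, self_inv_apply] at hmk
      rw [LinearMap.comp_apply, indLift_mk, LinearMap.comp_apply, Finsupp.lsingle_apply,
        Finsupp.lsum_single, ← hmk, LinearMap.id_apply])

theorem finrank_indV {k : Type*} [Field k] [Module k A] (S : Subgroup H)
    (σ : Representation k S A) :
    Module.finrank k (IndV S.subtype σ) = S.index * Module.finrank k A := by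
  obtain ⟨T, hT, -⟩ := S.exists_isComplement_right 1
  rw [(indEquivFinsupp hT σ).finrank_eq, Module.finrank, rank_finsupp, Cardinal.toNat_mul,
    Cardinal.toNat_lift, Cardinal.toNat_lift, ← hT.card_right]
  rfl

/-- Inducing a representation commutes with twisting by a character, and the latter does nothing
on a group in the kernel of the character. -/
noncomputable def indEquivTwist (χ : H →* ℤˣ) (hχ : ∀ g, χ (φ g) = 1) (ρ : Representation k G A) :
    (ind φ ρ).Equiv (twistRep χ (ind φ ρ)) :=
  have hlift (g : G) (h : H) (a : A) : ((χ (φ g * h) : ℤ) • IndV.mk φ ρ (φ g * h)) (ρ g a) =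
      ((χ h : ℤ) • IndV.mk φ ρ h) a := by
    rw [LinearMap.smul_apply, LinearMap.smul_apply, indMk_mul, map_mul, hχ, one_mul]
  let t : IndV φ ρ →ₗ[k] IndV φ ρ := indLift (fun h ↦ (χ h : ℤ) • IndV.mk φ ρ h) hlift
  have ht (h : H) (a : A) : t (IndV.mk φ ρ h a) = (χ h : ℤ) • IndV.mk φ ρ h a :=
    indLift_mk _ hlift h a
  have htt : t ∘ₗ t = LinearMap.id := ind_linearMap_ext fun h a ↦ by
    rw [LinearMap.comp_apply, ht, map_zsmul, ht, coe_zsmul_coe_zsmul, LinearMap.id_apply]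
  Representation.Equiv.mk (LinearEquiv.ofLinearMap t t htt htt) fun g ↦
    ind_linearMap_ext fun h a ↦ by
      change t (ind φ ρ g (IndV.mk φ ρ h a)) = twistRep χ (ind φ ρ) g (t (IndV.mk φ ρ h a))
      rw [ht, map_zsmul, twistRep_apply, ind_mk, ht, map_mul, map_inv, Units.val_mul, mul_smul,
        Int.units_inv_eq_self]

theorem indMk_resKer_eq (χ : H →* ℤˣ) (ρ : Representation k H A) {h : H} (g : H)
    (hgh : χ h = χ g) (a : A) :
    IndV.mk χ.ker.subtype (ρ.comp χ.ker.subtype) h a =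
      IndV.mk χ.ker.subtype (ρ.comp χ.ker.subtype) g (ρ g (ρ h⁻¹ a)) := by
  have hmem : g * h⁻¹ ∈ χ.ker := by rw [MonoidHom.mem_ker, map_mul, map_inv, hgh, mul_inv_cancel]
  simpa using (indMk_mul (φ := χ.ker.subtype) (ρ := ρ.comp χ.ker.subtype) ⟨_, hmem⟩ h a).symm

theorem prod_resKer_compat (χ : H →* ℤˣ) (ρ : Representation k H A) (g : χ.ker) (h : H) (a : A) :
    (ρ (χ.ker.subtype g * h)⁻¹).prod (twistRep χ ρ (χ.ker.subtype g * h)⁻¹)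
        ((ρ.comp χ.ker.subtype) g a) =
      (ρ h⁻¹).prod (twistRep χ ρ h⁻¹) a := by
  have hg : χ g = 1 := g.2
  simp [twistRep_apply, hg]

/-- Inducing the restriction of `ρ` to the kernel of a nontrivial character `χ` with values in
`{1, -1}` gives the sum of `ρ` and its twist by `χ`. -/
noncomputable def indResEquivProd [Invertible (2 : k)] (χ : H →* ℤˣ) {t : H} (ht : χ t = -1)
    (ρ : Representation k H A) :
    (ind χ.ker.subtype (ρ.comp χ.ker.subtype)).Equiv (ρ.prod (twistRep χ ρ)) :=
  let F : IndV χ.ker.subtype (ρ.comp χ.ker.subtype) →ₗ[k] A × A :=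
    indLift (fun h ↦ (ρ h⁻¹).prod (twistRep χ ρ h⁻¹)) (prod_resKer_compat χ ρ)
  have hF (h : H) (a : A) : F (IndV.mk _ _ h a) = (ρ h⁻¹ a, (χ h : ℤ) • ρ h⁻¹ a) := by
    simp only [F, indLift_mk, LinearMap.prod_apply, Function.prod_apply, twistRep_apply, map_inv,
      Int.units_inv_eq_self]
  let mk (h : H) := IndV.mk χ.ker.subtype (ρ.comp χ.ker.subtype) h
  let E : A × A →ₗ[k] IndV χ.ker.subtype (ρ.comp χ.ker.subtype) :=
    (⅟2 : k) • (mk 1 ∘ₗ (LinearMap.fst k A A + LinearMap.snd k A A) +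
      mk t ∘ₗ ρ t ∘ₗ (LinearMap.fst k A A - LinearMap.snd k A A))
  have hE (x y : A) : E (x, y) = (⅟2 : k) • (mk 1 (x + y) + mk t (ρ t (x - y))) := rfl
  have hFE : F ∘ₗ E = LinearMap.id := LinearMap.ext fun ⟨x, y⟩ ↦ by
    rw [LinearMap.comp_apply, hE, map_smul, map_add, hF, hF]
    refine Prod.ext ?_ ?_ <;>
      simp only [inv_one, map_one, Module.End.one_apply, inv_self_apply, ht, Prod.fst_add,
        Prod.snd_add, Prod.smul_fst, Prod.smul_snd, Units.val_one, Units.val_neg, neg_smul,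
        one_smul, LinearMap.id_apply, ← sub_eq_add_neg, add_add_sub_cancel, add_sub_sub_cancel,
        ← two_smul k, invOf_smul_smul]
  have hEF : E ∘ₗ F = LinearMap.id := ind_linearMap_ext fun h a ↦ by
    rw [LinearMap.comp_apply, hF, hE, LinearMap.id_apply, invOf_smul_eq_iff]
    rcases Int.units_eq_one_or (χ h) with hh | hh
    · rw [indMk_resKer_eq χ ρ (h := h) 1 (by rw [hh, map_one]), hh, Units.val_one, one_smul,
        sub_self, map_zero, map_zero, add_zero, ← two_smul k, map_smul, map_one,
        Module.End.one_apply]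
    · rw [indMk_resKer_eq χ ρ (h := h) t (by rw [hh, ht]), hh, Units.val_neg, Units.val_one,
        neg_one_smul, add_neg_cancel, sub_neg_eq_add, map_zero (mk 1), zero_add, ← two_smul k,
        map_smul, map_smul]
  Representation.Equiv.mk (LinearEquiv.ofLinearMap F E hFE hEF) fun g ↦
    ind_linearMap_ext fun h a ↦ by
      change F (ind _ _ g (IndV.mk _ _ h a)) = ρ.prod (twistRep χ ρ) g (F (IndV.mk _ _ h a))
      rw [ind_mk, hF, hF]
      simp [twistRep_apply, mul_smul, Int.units_inv_eq_self]

/-- The intertwining map `x ↦ ∑ h, h ⊗ f (ρ h x)` into an induced representation which corresponds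
to `f` under Frobenius reciprocity. -/
noncomputable def averageToInd {V : Type*} [AddCommGroup V] [Module k V] [Fintype H]
    {S : Subgroup H} {ρ : Representation k H V} {σ : Representation k S A}
    (f : IntertwiningMap (ρ.comp S.subtype) σ) : ρ.IntertwiningMap (ind S.subtype σ) where
  toLinearMap := ∑ h, IndV.mk S.subtype σ h ∘ₗ f.toLinearMap ∘ₗ ρ h
  isIntertwining' g := by
    ext x
    simp only [LinearMap.comp_apply, LinearMap.sum_apply, map_sum]
    exact Fintype.sum_equiv (Equiv.mulRight g) _ _ fun h ↦ by simp

theorem averageToInd_apply {V : Type*} [AddCommGroup V] [Module k V] [Fintype H]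
    {S : Subgroup H} {ρ : Representation k H V} {σ : Representation k S A}
    (f : IntertwiningMap (ρ.comp S.subtype) σ) (x : V) :
    averageToInd f x = ∑ h, IndV.mk S.subtype σ h (f (ρ h x)) :=
  LinearMap.sum_apply _ _ x

theorem exists_intertwiningMap_ind_ne_zero {k V : Type*} [Field k] [CharZero k] [Module k A]
    [AddCommGroup V] [Module k V] [Finite H] {S : Subgroup H} {ρ : Representation k H V}
    {σ : Representation k S A} (f : IntertwiningMap (ρ.comp S.subtype) σ) (hf : f ≠ 0) :
    ∃ F : ρ.IntertwiningMap (ind S.subtype σ), F ≠ 0 := by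
  classical
  cases nonempty_fintype H
  -- The counit `h ⊗ a ↦ h⁻¹ a` on `S`, extended by `0`, recovers `|S| f` from `averageToInd f`.
  let c (h : H) : A →ₗ[k] A := if hh : h ∈ S then σ ⟨h, hh⟩⁻¹ else 0
  have hc (s : S) (h : H) (a : A) : c (S.subtype s * h) (σ s a) = c h a := by
    by_cases hh : h ∈ S
    · have hsh : (⟨s * h, S.mul_mem s.2 hh⟩ : S) = s * ⟨h, hh⟩ := rfl
      have hmem : (s : H) * h ∈ S := S.mul_mem s.2 hh
      simp only [c, S.subtype_apply, dif_pos hh, dif_pos hmem, hsh, mul_inv_rev, map_mul,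
        Module.End.mul_apply, inv_self_apply]
    · simp [c, hh, S.mul_mem_cancel_left s.2]
  have hcf (x : V) (h : H) : c h (f (ρ h x)) = if h ∈ S then f x else 0 := by
    by_cases hh : h ∈ S
    · have hfh : f (ρ h x) = σ ⟨h, hh⟩ (f x) := f.isIntertwining _ _ ⟨h, hh⟩ x
      simp [c, hh, hfh]
    · simp [c, hh]
  have hF (x : V) : indLift c hc (averageToInd f x) = (Nat.card S : k) • f x := by
    rw [averageToInd_apply, map_sum]
    simp only [indLift_mk, hcf, Finset.sum_ite, Finset.sum_const_zero, add_zero, Finset.sum_const,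
      ← Fintype.card_subtype, Nat.card_eq_fintype_card, Nat.cast_smul_eq_nsmul]
  refine ⟨averageToInd f, fun h0 ↦ hf <| IntertwiningMap.ext <| LinearMap.ext fun x ↦ ?_⟩
  have hcard : (Nat.card S : k) ≠ 0 := Nat.cast_ne_zero.2 Nat.card_pos.ne'
  refine (smul_eq_zero_iff_right hcard).1 ((hF x).symm.trans ?_)
  rw [h0, IntertwiningMap.coe_zero, Pi.zero_apply, map_zero]

end Induction

section Minors

variable {α : Type*} [DecidableEq α]

/-- The principal minor with index set `A` of the permutation matrix of `g`. It vanishes unless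
`g` maps `A` to itself, and is then the sign of the permutation induced on `A`. -/
def principalMinor (A : Finset α) (g : Perm α) : ℤ :=
  ((g.permMatrix ℤ).submatrix (↑) (↑) : Matrix A A ℤ).det

theorem permMatrix_apply (g : Perm α) (i j : α) :
    g.permMatrix ℤ i j = if g i = j then 1 else 0 := by
  simp [PEquiv.toMatrix_apply, toPEquiv_apply, eq_comm]

theorem principalMinor_one (A : Finset α) : principalMinor A 1 = 1 := by
  rw [principalMinor, Matrix.permMatrix_one, Matrix.submatrix_one _ Subtype.val_injective,
    Matrix.det_one]

theorem principalMinor_inv (A : Finset α) (g : Perm α) :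
    principalMinor A g⁻¹ = principalMinor A g := by
  rw [principalMinor, ← Matrix.transpose_permMatrix, ← Matrix.transpose_submatrix,
    Matrix.det_transpose, principalMinor]

theorem principalMinor_mul_swap_of_mem {A : Finset α} {x y : α} (hx : x ∈ A) (hy : y ∈ A)
    (hxy : x ≠ y) (g : Perm α) :
    principalMinor A (g * swap x y) = -principalMinor A g := by
  have h := Matrix.det_permute (swap (⟨x, hx⟩ : A) ⟨y, hy⟩)
    ((g.permMatrix ℤ).submatrix (↑) (↑) : Matrix A A ℤ)
  rw [sign_swap (by simpa using hxy), Units.val_neg, Units.val_one, Int.cast_neg, Int.cast_one,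
    neg_one_mul] at h
  rw [principalMinor, principalMinor, ← h]
  congr 1
  ext i j
  have hi : ((swap (⟨x, hx⟩ : A) ⟨y, hy⟩ i : A) : α) = swap x y i := by
    simp only [swap_apply_def, Subtype.ext_iff]
    split_ifs <;> rfl
  simp only [Matrix.submatrix_apply, permMatrix_apply, mul_apply, id_eq, hi]

theorem principalMinor_mul_swap_of_notMem {A : Finset α} {x y : α} (hx : x ∉ A) (hy : y ∉ A)
    (g : Perm α) : principalMinor A (g * swap x y) = principalMinor A g := by
  rw [principalMinor, principalMinor]
  congr 1
  ext i j
  have hi : swap x y (i : α) = i :=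
    swap_apply_of_ne_of_ne (ne_of_mem_of_not_mem i.2 hx) (ne_of_mem_of_not_mem i.2 hy)
  simp only [Matrix.submatrix_apply, permMatrix_apply, mul_apply, hi]

theorem principalMinor_swap_mul_of_mem {A : Finset α} {x y : α} (hx : x ∈ A) (hy : y ∈ A)
    (hxy : x ≠ y) (g : Perm α) :
    principalMinor A (swap x y * g) = -principalMinor A g := by
  rw [← principalMinor_inv, mul_inv_rev, swap_inv, principalMinor_mul_swap_of_mem hx hy hxy,
    principalMinor_inv]

theorem principalMinor_swap_mul_of_notMem {A : Finset α} {x y : α} (hx : x ∉ A) (hy : y ∉ A)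
    (g : Perm α) : principalMinor A (swap x y * g) = principalMinor A g := by
  rw [← principalMinor_inv, mul_inv_rev, swap_inv, principalMinor_mul_swap_of_notMem hx hy,
    principalMinor_inv]

theorem principalMinor_eq_zero {A : Finset α} {x : α} (hx : x ∈ A) {g : Perm α} (hgx : g x ∉ A) :
    principalMinor A g = 0 := by
  refine Matrix.det_eq_zero_of_row_eq_zero ⟨x, hx⟩ fun j ↦ ?_
  have : g x ≠ j := fun h ↦ hgx (h ▸ j.2)
  simp only [Matrix.submatrix_apply, permMatrix_apply, if_neg this]

variable [Fintype α]

theorem principalMinor_univ (g : Perm α) : principalMinor univ g = sign g := by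
  have h := Matrix.det_submatrix_equiv_self (Equiv.subtypeUnivEquiv (p := (· ∈ (univ : Finset α)))
    mem_univ) (g.permMatrix ℤ)
  rw [Matrix.det_permutation] at h
  exact h

theorem sum_principalMinor_eq_det (a : α) (g : Perm α) :
    ∑ A with a ∈ A, (-1) ^ #A * principalMinor A g =
      (Matrix.diagonal (fun i ↦ if i = a then 0 else 1) - g.permMatrix ℤ).det := by
  have h := (Matrix.detRowAlternating (R := ℤ) (n := α)).map_add_univ
    (-(g.permMatrix ℤ).row) (Matrix.diagonal fun i ↦ if i = a then 0 else 1).row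
  rw [sub_eq_neg_add]
  refine Eq.trans ?_ h.symm
  rw [sum_filter]
  refine sum_congr rfl fun A _ ↦ ?_
  split_ifs with haA
  · have hrow : A.piecewise (-(g.permMatrix ℤ).row)
        (Matrix.diagonal fun i ↦ if i = a then 0 else 1).row =
        fun i ↦ (if i ∈ A then -1 else 1 : ℤ) • A.piecewise (g.permMatrix ℤ).row
          (1 : Matrix α α ℤ).row i := by
      funext i j
      by_cases hi : i ∈ A
      · simp only [piecewise_eq_of_mem _ _ _ hi, if_pos hi, Pi.neg_apply, Pi.smul_apply, neg_smul,
          one_smul]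
      · have : i ≠ a := fun h ↦ hi (h ▸ haA)
        simp [hi, this, Matrix.diagonal_apply, Matrix.one_apply]
    rw [hrow, AlternatingMap.map_smul_univ, prod_ite_mem, univ_inter, prod_const, smul_eq_mul]
    congr 1
    exact (Matrix.det_piecewise_one_eq_submatrix_det _ A).symm
  · refine (AlternatingMap.map_coord_zero _ a ?_).symm
    funext j
    simp [haA, Matrix.diagonal_apply]

theorem sum_principalMinor_eq_zero {a b : α} {g : Perm α} (hab : ¬g.SameCycle b a) :
    ∑ A with a ∈ A, (-1) ^ #A * principalMinor A g = 0 := by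
  rw [sum_principalMinor_eq_det, ← Matrix.exists_mulVec_eq_zero_iff]
  refine ⟨fun i ↦ if g.SameCycle b i then 1 else 0, fun h ↦ ?_, ?_⟩
  · simpa [SameCycle.refl] using congrFun h b
  · ext i
    rw [Matrix.sub_mulVec, Pi.sub_apply, Matrix.mulVec_diagonal, Matrix.permMatrix_mulVec]
    by_cases hi : i = a
    · simp [hi, hab]
    · simp [hi]

theorem sum_principalMinor_of_cycleType {a : α} {g : Perm α}
    (hg : g.cycleType = {Fintype.card α}) :
    ∑ A with a ∈ A, (-1) ^ #A * principalMinor A g = -1 := by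
  have hcyc : g.IsCycle := card_cycleType_eq_one.1 (by simp [hg])
  have hsupp : g.support = univ :=
    (card_eq_iff_eq_univ _).1 (by rw [← sum_cycleType, hg, Multiset.sum_singleton])
  rw [sum_eq_single_of_mem univ (by simp) fun A hA hne ↦ ?_, principalMinor_univ, hcyc.sign,
    hsupp]
  · simp [← mul_pow]
  · obtain ⟨x, hx, hgx⟩ : ∃ x ∈ A, g x ∉ A := by
      by_contra! hstab
      refine hne (eq_univ_of_forall fun b ↦ ?_)
      have hne_fix (x : α) : g x ≠ x := mem_support.1 (hsupp ▸ mem_univ x)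
      obtain ⟨i, rfl⟩ := hcyc.exists_pow_eq (hne_fix a) (hne_fix b)
      clear hne_fix
      induction i with
      | zero => simpa using hA
      | succ i ih => rw [pow_succ', mul_apply]; exact hstab _ ih
    rw [principalMinor_eq_zero hx hgx, mul_zero]

theorem sum_principalMinor [Nontrivial α] (a : α) (g : Perm α) :
    ∑ A with a ∈ A, (-1) ^ #A * principalMinor A g =
      if g.cycleType = {Fintype.card α} then -1 else 0 := by
  split_ifs with hg
  · exact sum_principalMinor_of_cycleType hg
  · obtain ⟨b, hb⟩ : ∃ b, ¬g.SameCycle b a := by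
      by_contra! h
      refine hg ?_
      obtain ⟨b, hba⟩ := exists_ne a
      have hne_fix (x : α) : g x ≠ x := fun hx ↦ hba <| by
        rw [← (h x).eq_of_left hx, ((h x).trans (h b).symm).eq_of_left hx]
      have hcyc : g.IsCycle := ⟨a, hne_fix a, fun y _ ↦ (h y).symm⟩
      have hsupp : g.support = univ := eq_univ_of_forall fun x ↦ mem_support.2 (hne_fix x)
      rw [hcyc.cycleType, hsupp, card_univ]
    exact sum_principalMinor_eq_zero hb

end Minors

section FixedVectors

variable {G K V : Type*} [Group G] [Field K] [AddCommGroup V] [Module K V]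
  {ρ : Representation K G V} {c : G}

theorem sum_pow_orderOf_apply_eq_zero (hfree : ∀ v, ρ c v = v → v = 0) (v : V) :
    ∑ i ∈ range (orderOf c), ρ (c ^ i) v = 0 := by
  refine hfree _ ?_
  rw [map_sum, ← sub_eq_zero, ← sum_sub_distrib]
  simp_rw [← Module.End.mul_apply, ← map_mul, ← pow_succ']
  rw [sum_range_sub (fun i ↦ ρ (c ^ i) v), pow_orderOf_eq_one, pow_zero, sub_self]

theorem sum_mul_mul_inv_eq {M : Type*} [AddCommMonoid M] {N : Subgroup G} [N.Normal] [Fintype N]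
    {g : G} (hN : ∀ n ∈ N, Commute g n → n = 1) (f : G → M) :
    ∑ s : N, f (s * g * (s : G)⁻¹) = ∑ s : N, f (s * g) := by
  let φ (s : N) : N := s * ⟨g * (s : G)⁻¹ * g⁻¹,
    Subgroup.Normal.conj_mem inferInstance _ (inv_mem s.2) _⟩
  have hφ (s : N) : (φ s : G) * g = s * g * (s : G)⁻¹ := by
    simp only [φ, Subgroup.coe_mul]; group
  have hinj : Function.Injective φ := fun s s' h ↦ by
    have hconj : (s : G) * g * (s : G)⁻¹ = s' * g * (s' : G)⁻¹ := by rw [← hφ, h, hφ]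
    have hcomm : Commute g ((s' : G)⁻¹ * s) := by
      rw [mul_inv_eq_iff_eq_mul] at hconj
      rw [commute_iff_eq, mul_assoc (s' : G)⁻¹, hconj]; group
    exact Subtype.ext (inv_mul_eq_one.mp (hN _ (mul_mem (inv_mem s'.2) s.2) hcomm)).symm
  rw [← (Finite.injective_iff_bijective.mp hinj).sum_comp fun s : N ↦ f (s * g)]
  simp only [hφ]

/-- If `c` fixes no nonzero vector, then `∑ i, c ^ i` vanishes on `V`, and so do its translates and
its conjugates by `N`. Summed over `N`, these agree except in the term `i = 0`. -/
theorem apply_eq_of_fixedPointFree [CharZero K] {N : Subgroup G} [N.Normal] [Finite N]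
    (hc : (orderOf c).Prime) (hN : ∀ n ∈ N, Commute c n → n = 1)
    (hfree : ∀ v, ρ c v = v → v = 0) {n : G} (hn : n ∈ N) (v : V) : ρ n v = v := by
  have := Fintype.ofFinite N
  have hzero (g h : G) : ∑ i ∈ range (orderOf c), ρ (g * c ^ i * h) v = 0 := by
    simp only [map_mul, Module.End.mul_apply, ← map_sum, sum_pow_orderOf_apply_eq_zero hfree,
      map_zero]
  have hpow {i : ℕ} (hi : i ∈ range (orderOf c)) (hi0 : i ≠ 0) (n : G) (hn : n ∈ N)
      (hcomm : Commute (c ^ i) n) : n = 1 := by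
    obtain ⟨j, hj⟩ := exists_pow_eq_self_of_coprime
      (Nat.coprime_of_lt_prime hi0 (mem_range.mp hi) hc).symm
    exact hN n hn (hj ▸ hcomm.pow_left j)
  have haverage : ∑ s : N, ρ s v = (Fintype.card N : K) • v := by
    have h : ∑ i ∈ range (orderOf c),
        ∑ s : N, (ρ (s * c ^ i * 1) v - ρ (s * c ^ i * (s : G)⁻¹) v) = 0 := by
      rw [sum_comm]
      simp only [sum_sub_distrib, hzero, sub_self, sum_const_zero]
    rw [sum_eq_single_of_mem 0 (mem_range.mpr hc.pos) fun i hi hi0 ↦ by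
      rw [sum_sub_distrib, sum_mul_mul_inv_eq (hpow hi hi0) fun g ↦ ρ g v]
      simp only [mul_one, sub_self]] at h
    simpa [sub_eq_zero, ← Nat.cast_smul_eq_nsmul K] using h
  have hcard : (Fintype.card N : K) ≠ 0 := Nat.cast_ne_zero.mpr Fintype.card_ne_zero
  rw [← smul_right_inj hcard, ← map_smul, ← haverage, map_sum]
  simp_rw [← Module.End.mul_apply, ← map_mul]
  exact Fintype.sum_equiv (Equiv.mulLeft ⟨n, hn⟩) _ _ fun s ↦ rfl

theorem zpow_apply_of_fixed {v : V} (h : ρ c v = v) (i : ℤ) : ρ (c ^ i) v = v := by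
  have hinv : ρ c⁻¹ v = v := by
    conv_lhs => rw [← h]
    rw [← Module.End.mul_apply, ← map_mul, inv_mul_cancel, map_one, Module.End.one_apply]
  induction i with
  | zero => simp
  | succ i ih => rw [zpow_add_one, map_mul, Module.End.mul_apply, h, ih]
  | pred i ih => rw [zpow_sub_one, map_mul, Module.End.mul_apply, hinv, ih]

/-- The vectors fixed by `c`. -/
def fixedSubmodule (ρ : Representation K G V) (c : G) : Submodule K V :=
  LinearMap.ker (ρ c - 1)

theorem mem_fixedSubmodule {v : V} : v ∈ fixedSubmodule ρ c ↔ ρ c v = v := by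
  rw [fixedSubmodule, LinearMap.mem_ker, LinearMap.sub_apply, Module.End.one_apply, sub_eq_zero]

theorem nontrivial_fixedSubmodule {v : V} (hv : v ≠ 0) (h : ρ c v = v) :
    Nontrivial (fixedSubmodule ρ c) :=
  ⟨⟨v, mem_fixedSubmodule.mpr h⟩, 0, fun h0 ↦ hv (congrArg Subtype.val h0)⟩

end FixedVectors

section PrimeCycles

theorem swap_induction_of_comp_eq {α β : Type*} [Finite α] [DecidableEq α] (f : α → β)
    {motive : Perm α → Prop} (one : motive 1)
    (swap_mul : ∀ g x y, x ≠ y → f x = f y → motive g → motive (swap x y * g))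
    (g : Perm α) (hg : ∀ x, f (g x) = f x) : motive g := by
  cases nonempty_fintype α
  induction hn : #g.support using Nat.strong_induction_on generalizing g with
  | _ n ih =>
    subst hn
    by_cases h1 : g = 1
    · exact h1 ▸ one
    obtain ⟨x, hx⟩ : ∃ x, g x ≠ x := by
      by_contra! h
      exact h1 (Perm.ext h)
    have hswap (y : α) : f (swap x (g x) y) = f y := by
      rw [swap_apply_def]
      split_ifs with h₁ h₂
      · rw [h₁, hg]
      · rw [h₂, hg]
      · rfl
    have ih' := ih _ (card_support_swap_mul hx) (swap x (g x) * g)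
      (fun y ↦ by rw [mul_apply, hswap, hg y]) rfl
    simpa [← mul_assoc] using swap_mul _ x (g x) hx.symm (hg x).symm ih'

variable {α : Type*} [DecidableEq α] {K V : Type*} [Field K] [AddCommGroup V]
  [Module K V]

/-- A vector on which the symmetric group of the letters in `A` acts by the sign and the symmetric
group of the other letters acts trivially. It generates a quotient of the representation induced
from `sgn ⊗ 1`, whose constituents are indexed by two hooks. -/
structure IsHookVector (ρ : Representation K (Perm α) V) (A : Finset α) (u : V) : Prop where
  swap_of_mem : ∀ x ∈ A, ∀ y ∈ A, x ≠ y → ρ (swap x y) u = -u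
  swap_of_notMem : ∀ x ∉ A, ∀ y ∉ A, ρ (swap x y) u = u

variable {ρ : Representation K (Perm α) V} {A : Finset α} {u : V}

namespace IsHookVector

theorem apply_of_mapsTo [Finite α] (hu : IsHookVector ρ A u) {g : Perm α} (hg : ∀ x ∈ A, g x ∈ A) :
    ρ g u = principalMinor A g • u ∧ (principalMinor A g = 1 ∨ principalMinor A g = -1) := by
  have hiff (x : α) : (g x ∈ A) = (x ∈ A) :=
    propext ⟨fun h ↦ by simpa using perm_symm_on_of_perm_on_finset hg h, hg x⟩
  refine swap_induction_of_comp_eq (· ∈ A) (motive := fun g ↦ ρ g u = principalMinor A g • u ∧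
    (principalMinor A g = 1 ∨ principalMinor A g = -1)) ?_ ?_ g hiff
  · simp [principalMinor_one]
  · rintro g x y hxy hiff ⟨hgu, hminor⟩
    rw [map_mul, Module.End.mul_apply, hgu, map_zsmul]
    by_cases hx : x ∈ A
    · have hy : y ∈ A := hiff ▸ hx
      rw [principalMinor_swap_mul_of_mem hx hy hxy, hu.swap_of_mem x hx y hy hxy, neg_smul,
        smul_neg]
      exact ⟨rfl, by lia⟩
    · have hy : y ∉ A := hiff ▸ hx
      rw [principalMinor_swap_mul_of_notMem hx hy, hu.swap_of_notMem x hx y hy]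
      exact ⟨rfl, hminor⟩

theorem apply_of_forall_mem_eq [Finite α] (hu : IsHookVector ρ A u) {g : Perm α}
    (hg : ∀ x ∈ A, g x = x) : ρ g u = u := by
  let f (x : α) : Option α := if x ∈ A then some x else none
  have hfg (x : α) : f (g x) = f x := by
    have (x : α) (hx : x ∉ A) : g x ∉ A := fun h ↦ hx (g.injective (hg _ h) ▸ h)
    grind
  refine swap_induction_of_comp_eq f (motive := fun g ↦ ρ g u = u) ?_ ?_ g hfg
  · rw [map_one, Module.End.one_apply]
  · intro g x y hxy hf hgu
    have hx : x ∉ A := by grind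
    have hy : y ∉ A := by grind
    rw [map_mul, Module.End.mul_apply, hgu, hu.swap_of_notMem x hx y hy]

end IsHookVector

variable [Fintype α]

variable (ρ A) in
/-- The operator by which `∑ g, principalMinor A g • g` acts; its image consists of hook
vectors. -/
def hookOperator : V →ₗ[K] V :=
  ∑ g, principalMinor A g • ρ g

theorem hookOperator_apply (v : V) :
    hookOperator ρ A v = ∑ g, principalMinor A g • ρ g v := by
  simp [hookOperator]

theorem isHookVector_hookOperator (v : V) : IsHookVector ρ A (hookOperator ρ A v) := by
  have hswap (x y : α) : ρ (swap x y) (hookOperator ρ A v) =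
      ∑ g, principalMinor A (swap x y * g) • ρ g v := by
    rw [hookOperator_apply, map_sum]
    refine Fintype.sum_equiv (Equiv.mulLeft (swap x y)) _ _ fun g ↦ ?_
    rw [coe_mulLeft, ← mul_assoc, swap_mul_self, one_mul, map_zsmul, map_mul, Module.End.mul_apply]
  constructor
  · intro x hx y hy hxy
    rw [hswap, hookOperator_apply]
    simp only [principalMinor_swap_mul_of_mem hx hy hxy, neg_smul, sum_neg_distrib]
  · intro x hx y hy
    rw [hswap, hookOperator_apply]
    simp only [principalMinor_swap_mul_of_notMem hx hy]

theorem hookOperator_swap_of_notMem {x y : α} (hx : x ∉ A) (hy : y ∉ A) (v : V) :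
    hookOperator ρ A (ρ (swap x y) v) = hookOperator ρ A v := by
  rw [hookOperator_apply, hookOperator_apply]
  refine Fintype.sum_equiv (Equiv.mulRight (swap x y)) _ _ fun g ↦ ?_
  rw [coe_mulRight, principalMinor_mul_swap_of_notMem hx hy, map_mul, Module.End.mul_apply]

namespace IsHookVector

theorem hookOperator_ne_zero [CharZero K] (hu : IsHookVector ρ A u) (h0 : u ≠ 0) :
    hookOperator ρ A u ≠ 0 := by
  have hterm (g : Perm α) : principalMinor A g • ρ g u = principalMinor A g ^ 2 • u := by
    by_cases hg : ∀ x ∈ A, g x ∈ A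
    · rw [(hu.apply_of_mapsTo hg).1, smul_smul, sq]
    · push Not at hg
      obtain ⟨x, hx, hgx⟩ := hg
      simp [principalMinor_eq_zero hx hgx]
  have hpos : 0 < ∑ g, principalMinor A g ^ 2 :=
    sum_pos' (fun g _ ↦ sq_nonneg _) ⟨1, mem_univ _, by simp [principalMinor_one]⟩
  rw [hookOperator_apply, sum_congr rfl fun g _ ↦ hterm g, ← sum_smul, ← Int.cast_smul_eq_zsmul K]
  exact smul_ne_zero (mod_cast hpos.ne') h0

theorem add_sum_swap (hu : IsHookVector ρ A u) {a : α} (ha : a ∈ A) :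
    IsHookVector ρ (A.erase a) (u + ∑ b ∈ Aᶜ, ρ (swap a b) u) := by
  have hB : (A.erase a)ᶜ = insert a Aᶜ := compl_erase
  have hvec : u + ∑ b ∈ Aᶜ, ρ (swap a b) u = ∑ b ∈ (A.erase a)ᶜ, ρ (swap a b) u := by
    rw [hB, sum_insert (by simpa using ha), swap_self, ← Perm.one_def, map_one,
      Module.End.one_apply]
  rw [hvec]
  constructor
  · intro x hx y hy hxy
    rw [map_sum, ← sum_neg_distrib]
    refine sum_congr rfl fun b hb ↦ ?_
    have hx' := ne_of_mem_of_not_mem hx (mem_compl.1 hb)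
    have hy' := ne_of_mem_of_not_mem hy (mem_compl.1 hb)
    have hcomm : swap x y * swap a b = swap a b * swap x y := by
      rw [swap_mul_eq_mul_swap, swap_inv, swap_apply_of_ne_of_ne (ne_of_mem_erase hx) hx',
        swap_apply_of_ne_of_ne (ne_of_mem_erase hy) hy']
    rw [← Module.End.mul_apply, ← map_mul, hcomm, map_mul, Module.End.mul_apply,
      hu.swap_of_mem x (mem_of_mem_erase hx) y (mem_of_mem_erase hy) hxy, map_neg]
  · intro x hx y hy
    have hmem (b : α) : swap x y b ∈ (A.erase a)ᶜ ↔ b ∈ (A.erase a)ᶜ := by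
      rw [mem_compl, mem_compl, swap_apply_def]
      split_ifs with h₁ h₂ <;> simp only [*]
    rw [map_sum]
    refine sum_equiv (swap x y) (fun b ↦ (hmem b).symm) fun b hb ↦ ?_
    set h : Perm α := swap a (swap x y b) * swap x y * swap a b with hh
    have hfix : ρ h u = u := by
      refine hu.apply_of_forall_mem_eq fun z hz ↦ ?_
      simp only [mem_compl, mem_erase, not_and, Perm.mul_apply, hh] at hx hy hb ⊢
      grind
    calc ρ (swap x y) (ρ (swap a b) u) = ρ (swap a (swap x y b) * h) u := by
          rw [hh, ← Module.End.mul_apply, ← map_mul]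
          simp [← mul_assoc]
      _ = ρ (swap a (swap x y b)) u := by rw [map_mul, Module.End.mul_apply, hfix]

end IsHookVector

/-- No nonzero vector is fixed by a cycle of length `ℓ`. -/
def CyclesFixNoVector (ρ : Representation K (Perm α) V) (ℓ : ℕ) : Prop :=
  ∀ g : Perm α, g.cycleType = {ℓ} → ∀ v, ρ g v = v → v = 0

theorem sum_pow_apply_eq_zero {ℓ : ℕ} (hfree : CyclesFixNoVector ρ ℓ) {g : Perm α}
    (hg : g.cycleType = {ℓ}) (v : V) : ∑ i ∈ range ℓ, ρ (g ^ i) v = 0 := by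
  have horder : orderOf g = ℓ := by
    rw [← lcm_cycleType, hg, Multiset.lcm_singleton, normalize_eq]
  rw [← horder, sum_pow_orderOf_apply_eq_zero (hfree g hg)]

theorem exists_cycleType_eq_card (hp : (Fintype.card α).Prime) :
    ∃ c : Perm α, c.cycleType = {Fintype.card α} :=
  (exists_with_cycleType_iff α).2 ⟨by simp, by simpa using hp.two_le⟩

theorem cycleType_eq_card_iff_orderOf (hp : (Fintype.card α).Prime) {g : Perm α} :
    g.cycleType = {Fintype.card α} ↔ orderOf g = Fintype.card α := by
  refine ⟨fun h ↦ by rw [← lcm_cycleType, h, Multiset.lcm_singleton, normalize_eq], fun h ↦ ?_⟩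
  obtain ⟨n, hn⟩ := cycleType_prime_order (h ▸ hp)
  have hle : (n + 1) * Fintype.card α ≤ Fintype.card α := by
    have := g.support.card_le_univ
    rwa [← sum_cycleType, hn, Multiset.sum_replicate, smul_eq_mul, h] at this
  have hn0 : n = 0 := by nlinarith [hp.pos]
  rw [hn, hn0, h, Multiset.replicate_one]

theorem sum_fullCycles_pow {M : Type*} [AddCommMonoid M] (hp : (Fintype.card α).Prime) {i : ℕ}
    (hi : i ≠ 0) (hip : i < Fintype.card α) (f : Perm α → M) :
    ∑ g with g.cycleType = {Fintype.card α}, f (g ^ i) =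
      ∑ g with g.cycleType = {Fintype.card α}, f g := by
  simp only [cycleType_eq_card_iff_orderOf hp]
  have hcop : (Fintype.card α).Coprime i := Nat.coprime_of_lt_prime hi hip hp
  obtain ⟨j, -, hij⟩ := Nat.exists_mul_mod_eq_one_of_coprime hcop.symm hp.one_lt
  have hinv (g : Perm α) (hg : orderOf g = Fintype.card α) : g ^ (i * j) = g := by
    rw [← pow_mod_orderOf, hg, hij, pow_one]
  have hj : (Fintype.card α).Coprime j :=
    (Nat.coprime_of_mul_modEq_one i
      (by rw [mul_comm, Nat.ModEq, hij, Nat.mod_eq_of_lt hp.one_lt])).symm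
  have hpow {k : ℕ} (hk : (Fintype.card α).Coprime k) (g : Perm α)
      (hg : g ∈ ({g | orderOf g = Fintype.card α} : Finset (Perm α))) :
      g ^ k ∈ ({g | orderOf g = Fintype.card α} : Finset (Perm α)) := by
    simp only [mem_filter_univ] at hg ⊢
    rw [Nat.Coprime.orderOf_pow (hg ▸ hk), hg]
  exact sum_nbij' (· ^ i) (· ^ j) (hpow hcop) (hpow hj)
    (fun g hg ↦ by rw [← pow_mul, hinv g (mem_filter_univ g |>.1 hg)])
    (fun g hg ↦ by rw [← pow_mul, mul_comm, hinv g (mem_filter_univ g |>.1 hg)]) fun _ _ ↦ rfl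

theorem sum_fullCycles_apply_eq_zero [Nontrivial α]
    (hzero : ∀ A : Finset α, ∀ u, IsHookVector ρ A u → u = 0) (v : V) :
    ∑ g with g.cycleType = {Fintype.card α}, ρ g v = 0 := by
  obtain ⟨a⟩ := (inferInstance : Nonempty α)
  have h : ∑ A with a ∈ A, (-1 : ℤ) ^ #A • hookOperator ρ A v = 0 :=
    sum_eq_zero fun A _ ↦ by rw [hzero A _ (isHookVector_hookOperator v), smul_zero]
  simp only [hookOperator_apply, smul_sum, smul_smul] at h
  rw [sum_comm] at h
  simp only [← sum_smul, sum_principalMinor a, ite_smul, neg_smul, one_smul, zero_smul] at h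
  rwa [← sum_filter, sum_neg_distrib, neg_eq_zero] at h

theorem exists_isHookVector [CharZero K] [Nontrivial V] (hp : (Fintype.card α).Prime)
    (hfree : CyclesFixNoVector ρ (Fintype.card α)) :
    ∃ A : Finset α, ∃ u ≠ 0, IsHookVector ρ A u := by
  by_contra! hzero
  have hzero' (A : Finset α) (u : V) (hu : IsHookVector ρ A u) : u = 0 := by
    by_contra h0
    exact hzero A u h0 hu
  have : Nontrivial α := Fintype.one_lt_card_iff_nontrivial.1 hp.one_lt
  obtain ⟨v, hv⟩ := exists_ne (0 : V)
  obtain ⟨c, hc⟩ := exists_cycleType_eq_card hp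
  have hsum : ∑ g : Perm α with g.cycleType = {Fintype.card α},
      ∑ i ∈ range (Fintype.card α), ρ (g ^ i) v = 0 :=
    sum_eq_zero fun g hg ↦ sum_pow_apply_eq_zero hfree (by simpa using hg) v
  have hne : ∀ i ∈ range (Fintype.card α), i ≠ 0 →
      ∑ g : Perm α with g.cycleType = {Fintype.card α}, ρ (g ^ i) v = 0 := fun i hi hi0 ↦ by
    rw [sum_fullCycles_pow hp hi0 (mem_range.1 hi) (ρ · v), sum_fullCycles_apply_eq_zero hzero']
  rw [sum_comm, sum_eq_single_of_mem 0 (mem_range.2 hp.pos) hne] at hsum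
  simp only [pow_zero, map_one, Module.End.one_apply, sum_const] at hsum
  have hcard : #{g : Perm α | g.cycleType = {Fintype.card α}} ≠ 0 :=
    card_ne_zero_of_mem (mem_filter_univ c |>.2 hc)
  rw [← Nat.cast_smul_eq_nsmul K] at hsum
  exact smul_ne_zero (Nat.cast_ne_zero.2 hcard) hv hsum

/-- In the coordinate `e` the set `A` is an initial interval and `c` is the rotation
`x ↦ x + 1`. -/
structure IsRotation (A : Finset α) (e : α ≃ Fin (Fintype.card α)) (c : Perm α) : Prop where
  mem_iff : ∀ x, x ∈ A ↔ (e x : ℕ) < #A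
  pow_apply : ∀ i x, (e ((c ^ i) x) : ℕ) = (e x + i) % Fintype.card α

theorem exists_isRotation (hp : (Fintype.card α).Prime) (A : Finset α) :
    ∃ (e : α ≃ Fin (Fintype.card α)) (c : Perm α), IsRotation A e c ∧
      c.cycleType = {Fintype.card α} := by
  have : NeZero (Fintype.card α) := ⟨hp.ne_zero⟩
  obtain ⟨e, he⟩ : ∃ e : α ≃ Fin (Fintype.card α), ∀ x, x ∈ A ↔ (e x : ℕ) < #A := by
    let e₀ := Fintype.equivFin α
    have hcard : Fintype.card {j // e₀.symm j ∈ A} =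
        Fintype.card {j : Fin (Fintype.card α) // (j : ℕ) < #A} := by
      rw [Fintype.card_congr (e₀.symm.subtypeEquiv (q := (· ∈ A)) fun _ ↦ Iff.rfl),
        Fintype.card_coe, Fintype.card_subtype, Fin.card_filter_val_lt,
        min_eq_right A.card_le_univ]
    let σ := Fintype.equivOfCardEq hcard
    refine ⟨e₀.trans σ.extendSubtype, fun x ↦ ⟨fun hx ↦ ?_, fun hx ↦ ?_⟩⟩
    · exact σ.extendSubtype_mem _ (by simpa using hx)
    · by_contra hxA
      exact σ.extendSubtype_not_mem (e₀ x) (by simpa using hxA) hx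
  let c : Perm α := e.permCongr.symm (Equiv.addRight 1)
  have hc (x : α) : e (c x) = e x + 1 := by simp [c]
  have hpow (i : ℕ) (x : α) : (e ((c ^ i) x) : ℕ) = (e x + i) % Fintype.card α := by
    induction i with
    | zero => simp [Nat.mod_eq_of_lt]
    | succ i ih => rw [pow_succ', mul_apply, hc, Fin.val_add, ih]; simp [add_assoc]
  have : Fact (Fintype.card α).Prime := ⟨hp⟩
  refine ⟨e, c, ⟨he, hpow⟩, (cycleType_eq_card_iff_orderOf hp).2 (orderOf_eq_prime ?_ ?_)⟩
  · ext x
    exact e.injective (Fin.ext (by simp [hpow, Nat.mod_eq_of_lt]))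
  · intro h
    have := hpow 1 (e.symm 0)
    simp [h, Nat.mod_eq_of_lt hp.one_lt] at this

namespace IsHookVector

theorem hookOperator_apply_eq_zero [CharZero K] (hu : IsHookVector ρ A u) {g : Perm α} {x y : α}
    (hx : x ∈ A) (hy : y ∈ A) (hxy : x ≠ y) (hgx : g x ∉ A) (hgy : g y ∉ A) :
    hookOperator ρ A (ρ g u) = 0 := by
  have h : ρ (swap (g x) (g y)) (ρ g u) = -ρ g u := by
    rw [← Module.End.mul_apply, ← map_mul, ← mul_swap_eq_swap_mul, map_mul, Module.End.mul_apply,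
      hu.swap_of_mem x hx y hy hxy, map_neg]
  have hN := hookOperator_swap_of_notMem (ρ := ρ) hgx hgy (ρ g u)
  rw [h, map_neg] at hN
  have htorsion := IsAddTorsionFree.of_isTorsionFree K V
  exact self_eq_neg.1 hN.symm

theorem card_compl_smul_hookOperator_swap (hu : IsHookVector ρ A u) {a b : α} (ha : a ∈ A)
    (hb : b ∉ A) (hzero : ∀ v, IsHookVector ρ (A.erase a) v → v = 0) :
    #Aᶜ • hookOperator ρ A (ρ (swap a b) u) = -hookOperator ρ A u := by
  have hterm (b' : α) (hb' : b' ∈ Aᶜ) :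
      hookOperator ρ A (ρ (swap a b') u) = hookOperator ρ A (ρ (swap a b) u) := by
    rw [mem_compl] at hb'
    rw [swap_comm, ← swap_mul_swap_mul_swap (ne_of_mem_of_not_mem ha hb)
      (ne_of_mem_of_not_mem ha hb'), mul_assoc, map_mul, Module.End.mul_apply,
      hookOperator_swap_of_notMem hb hb', map_mul, Module.End.mul_apply,
      hu.swap_of_notMem b hb b' hb']
  have h := congr_arg (hookOperator ρ A) (hzero _ (hu.add_sum_swap ha))
  rw [map_add, map_sum, sum_congr rfl hterm, sum_const, map_zero] at h
  exact (neg_eq_of_add_eq_zero_right h).symm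

theorem card_compl_smul_hookOperator_apply (hu : IsHookVector ρ A u) {g : Perm α} {a b : α}
    (ha : a ∈ A) (hb : b ∉ A) (hg : ∀ x ∈ A, (swap a b * g) x ∈ A)
    (hzero : ∀ v, IsHookVector ρ (A.erase a) v → v = 0) :
    ∃ s : ℤ, (s = 1 ∨ s = -1) ∧ #Aᶜ • hookOperator ρ A (ρ g u) = s • hookOperator ρ A u := by
  obtain ⟨h₁, h₂⟩ := hu.apply_of_mapsTo hg
  refine ⟨-principalMinor A (swap a b * g), by lia, ?_⟩
  have hgu : ρ g u = ρ (swap a b) (ρ (swap a b * g) u) := by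
    rw [← Module.End.mul_apply, ← map_mul, ← mul_assoc, swap_mul_self, one_mul]
  rw [hgu, h₁, map_zsmul, map_zsmul, smul_comm, hu.card_compl_smul_hookOperator_swap ha hb hzero,
    smul_neg, neg_smul]

end IsHookVector

namespace IsRotation

variable {e : α ≃ Fin (Fintype.card α)} {c : Perm α}

omit [DecidableEq α] in
theorem symm_mem_iff (hc : IsRotation A e c) {j : ℕ} (hj : j < Fintype.card α) :
    e.symm ⟨j, hj⟩ ∈ A ↔ j < #A := by
  rw [hc.mem_iff, apply_symm_apply]

theorem hookOperator_pow_apply_eq_zero [CharZero K] (hc : IsRotation A e c)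
    (hu : IsHookVector ρ A u) (hA : 2 ≤ #A) (hAc : #A + 2 ≤ Fintype.card α) {i : ℕ} (hi : 2 ≤ i)
    (hip : i + 2 ≤ Fintype.card α) : hookOperator ρ A (ρ (c ^ i) u) = 0 := by
  have hx : #A - i + 1 < Fintype.card α := by lia
  refine hu.hookOperator_apply_eq_zero (x := e.symm ⟨#A - i, by lia⟩)
    (y := e.symm ⟨#A - i + 1, hx⟩) ?_ ?_ ?_ ?_ ?_
  · rw [hc.symm_mem_iff]; lia
  · rw [hc.symm_mem_iff]; lia
  · simp
  · rw [hc.mem_iff, hc.pow_apply, apply_symm_apply, Nat.mod_eq_of_lt] <;> grind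
  · rw [hc.mem_iff, hc.pow_apply, apply_symm_apply, Nat.mod_eq_of_lt] <;> grind

theorem card_compl_smul_hookOperator_pow_apply (hc : IsRotation A e c) (hu : IsHookVector ρ A u)
    (hzero : ∀ a ∈ A, ∀ v, IsHookVector ρ (A.erase a) v → v = 0) {i j k : ℕ} (hj : j < #A)
    (hkA : #A ≤ k) (hk : k < Fintype.card α)
    (hjk : ∀ l < #A, (l + i) % Fintype.card α = k ∨
      (l + i) % Fintype.card α < #A ∧ (l + i) % Fintype.card α ≠ j) :
    ∃ s : ℤ, (s = 1 ∨ s = -1) ∧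
      #Aᶜ • hookOperator ρ A (ρ (c ^ i) u) = s • hookOperator ρ A u := by
  have ha : e.symm ⟨j, by lia⟩ ∈ A := by rwa [hc.symm_mem_iff]
  refine hu.card_compl_smul_hookOperator_apply (b := e.symm ⟨k, hk⟩) ha
    (by rw [hc.symm_mem_iff]; lia) (fun x hx ↦ ?_) (hzero _ ha)
  rw [mul_apply, swap_apply_def, hc.mem_iff]
  simp only [eq_symm_apply, Fin.ext_iff, hc.pow_apply]
  have := hjk (e x) ((hc.mem_iff x).1 hx)
  split_ifs with h₁ h₂
  · lia
  · rwa [apply_symm_apply]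
  · rw [hc.pow_apply]; lia

end IsRotation

/-- Under the full cycle rotating `A` as an interval, only the rotations by `0` and `±1` move at
most one letter out of `A`, so only they contribute to `∑ i, hookOperator ρ A (ρ (c ^ i) u) = 0`. -/
theorem IsHookVector.exists_isHookVector_erase [CharZero K] (hu : IsHookVector ρ A u) (h0 : u ≠ 0)
    (hp : (Fintype.card α).Prime) (hfree : CyclesFixNoVector ρ (Fintype.card α)) (hA : 2 ≤ #A)
    (hAc : 3 ≤ #Aᶜ) : ∃ a ∈ A, ∃ v ≠ 0, IsHookVector ρ (A.erase a) v := by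
  by_contra! h
  have hzero (a : α) (ha : a ∈ A) (v : V) (hv : IsHookVector ρ (A.erase a) v) : v = 0 := by
    by_contra hv0
    exact h a ha v hv0 hv
  obtain ⟨e, c, hc, hcycle⟩ := exists_isRotation hp A
  have hcard : #A + #Aᶜ = Fintype.card α := card_add_card_compl A
  obtain ⟨s, hs, h₁⟩ := hc.card_compl_smul_hookOperator_pow_apply hu hzero (i := 1) (j := 0)
    (k := #A) (by lia) le_rfl (by lia) fun l hl ↦ by rw [Nat.mod_eq_of_lt] <;> lia
  obtain ⟨t, ht, h₂⟩ := hc.card_compl_smul_hookOperator_pow_apply hu hzero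
    (i := Fintype.card α - 1) (j := #A - 1) (k := Fintype.card α - 1) (by lia) (by lia) (by lia)
    fun l hl ↦ by
      rcases l.eq_zero_or_pos with rfl | hl0
      · left; rw [Nat.mod_eq_of_lt] <;> lia
      · right; rw [Nat.mod_eq_sub_mod (by lia), Nat.mod_eq_of_lt] <;> lia
  have hsum := congr_arg (hookOperator ρ A) (sum_pow_apply_eq_zero hfree hcycle u)
  obtain ⟨m, hm⟩ : ∃ m, Fintype.card α = m + 3 := ⟨Fintype.card α - 3, by lia⟩
  have hfar (i : ℕ) (hi : i ∈ range m) : hookOperator ρ A (ρ (c ^ (i + 1 + 1)) u) = 0 :=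
    hc.hookOperator_pow_apply_eq_zero hu hA (by lia) (by lia) (by grind)
  rw [map_sum, map_zero, hm, sum_range_succ, sum_range_succ', sum_range_succ',
    sum_eq_zero hfar, zero_add, zero_add, pow_zero, map_one, Module.End.one_apply] at hsum
  have htotal : (s + #Aᶜ + t) • hookOperator ρ A u = 0 := by
    have := congr_arg (#Aᶜ • ·) hsum
    rw [hm, Nat.add_succ_sub_one] at h₂
    simp only [smul_add, smul_zero] at this
    rw [h₁, h₂] at this
    rwa [add_smul, add_smul, natCast_zsmul]
  rw [← Int.cast_smul_eq_zsmul K] at htotal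
  exact smul_ne_zero (Int.cast_ne_zero.2 (by lia)) (hu.hookOperator_ne_zero h0) htotal

theorem IsHookVector.twist_sign (hu : IsHookVector ρ A u) :
    IsHookVector (twistRep sign ρ) Aᶜ u := by
  constructor
  · intro x hx y hy hxy
    rw [twistRep_apply, hu.swap_of_notMem x (mem_compl.1 hx) y (mem_compl.1 hy),
      sign_swap hxy, Units.val_neg, Units.val_one, neg_one_smul]
  · intro x hx y hy
    rw [notMem_compl] at hx hy
    obtain rfl | hxy := eq_or_ne x y
    · rw [swap_self, ← Perm.one_def, map_one, Module.End.one_apply]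
    · rw [twistRep_apply, hu.swap_of_mem x hx y hy hxy, sign_swap hxy, Units.val_neg,
        Units.val_one, neg_one_smul, neg_neg]

variable (ρ) in
/-- There is a nonzero hook vector for some set of `k` letters. -/
def HasHookVector (k : ℕ) : Prop :=
  ∃ A : Finset α, #A = k ∧ ∃ u ≠ 0, IsHookVector ρ A u

namespace HasHookVector

variable {k : ℕ}

theorem twist_sign (h : HasHookVector ρ k) :
    HasHookVector (twistRep sign ρ) (Fintype.card α - k) := by
  obtain ⟨A, rfl, u, h0, hu⟩ := h
  exact ⟨Aᶜ, card_compl A, u, h0, hu.twist_sign⟩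

theorem one [CharZero K] (h : HasHookVector ρ k) (hp : (Fintype.card α).Prime)
    (hfree : CyclesFixNoVector ρ (Fintype.card α)) (hk : k ≠ 0)
    (hkp : k = 1 ∨ k + 3 ≤ Fintype.card α) :
    HasHookVector ρ 1 := by
  induction k, Nat.one_le_iff_ne_zero.2 hk using Nat.le_induction with
  | base => exact h
  | succ k hk1 ih =>
    obtain ⟨A, hA, u, h0, hu⟩ := h
    have hAc := card_add_card_compl A
    obtain ⟨a, ha, v, hv0, hv⟩ :=
      hu.exists_isHookVector_erase h0 hp hfree (by lia) (by lia)
    exact ih ⟨A.erase a, by rw [card_erase_of_mem ha, hA, Nat.add_sub_cancel], v, hv0, hv⟩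
      (by lia) (by lia)

end HasHookVector

theorem not_hasHookVector_zero (hp : (Fintype.card α).Prime)
    (hfree : CyclesFixNoVector ρ (Fintype.card α)) : ¬HasHookVector ρ 0 := by
  rintro ⟨A, hA, u, h0, hu⟩
  obtain ⟨c, hc⟩ := exists_cycleType_eq_card hp
  obtain rfl := card_eq_zero.1 hA
  exact h0 (hfree c hc u (hu.apply_of_forall_mem_eq (by simp)))

theorem sign_eq_one_of_cycleType_eq_singleton {ℓ : ℕ} (hℓ : Odd ℓ) {g : Perm α}
    (hg : g.cycleType = {ℓ}) : sign g = 1 := by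
  rw [sign_of_cycleType, hg, Multiset.sum_singleton, Multiset.card_singleton,
    hℓ.add_one.neg_one_pow]

theorem CyclesFixNoVector.twist_sign {ℓ : ℕ} (hℓ : Odd ℓ) (hfree : CyclesFixNoVector ρ ℓ) :
    CyclesFixNoVector (twistRep sign ρ) ℓ := fun g hg v hv ↦ by
  rw [twistRep_apply, sign_eq_one_of_cycleType_eq_singleton hℓ hg, Units.val_one, one_smul] at hv
  exact hfree g hg v hv

theorem hasHookVector_one_or_twist_sign [CharZero K] [Nontrivial V] (hp : (Fintype.card α).Prime)
    (hodd : Odd (Fintype.card α)) (hfree : CyclesFixNoVector ρ (Fintype.card α)) :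
    HasHookVector ρ 1 ∨ HasHookVector (twistRep sign ρ) 1 := by
  obtain ⟨A, u, h0, hu⟩ := exists_isHookVector hp hfree
  have hA : HasHookVector ρ #A := ⟨A, rfl, u, h0, hu⟩
  have htwist := hfree.twist_sign hodd
  have hne : #A ≠ 0 := fun h ↦ not_hasHookVector_zero hp hfree (h ▸ hA)
  have hlt : #A < Fintype.card α := by
    refine (A.card_le_univ).lt_of_ne fun h ↦ not_hasHookVector_zero hp htwist ?_
    simpa [h] using hA.twist_sign
  by_cases hA1 : #A = 1 ∨ #A + 3 ≤ Fintype.card α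
  · exact .inl (hA.one hp hfree hne hA1)
  · have hodd' := Nat.odd_iff.1 hodd
    exact .inr (hA.twist_sign.one hp htwist (by lia) (by lia))

theorem exists_fixed_of_cyclesFixNoVector [CharZero K] [Nontrivial V]
    (hp : (Fintype.card α).Prime) (hodd : Odd (Fintype.card α))
    (hfree : CyclesFixNoVector ρ (Fintype.card α)) :
    ∃ x, ∃ v ≠ 0, ∀ g : Perm α, sign g = 1 → g x = x → ρ g v = v := by
  obtain ⟨A, hA, u, h0, hu⟩ | ⟨A, hA, u, h0, hu⟩ := hasHookVector_one_or_twist_sign hp hodd hfree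
  all_goals
    obtain ⟨x, rfl⟩ := card_eq_one.1 hA
    refine ⟨x, u, h0, fun g hsign hx ↦ ?_⟩
    have := hu.apply_of_forall_mem_eq (g := g) (by simpa)
  · exact this
  · rwa [twistRep_apply, hsign, Units.val_one, one_smul] at this

theorem exists_cycle_of_path {p : ℕ} (hp : 5 ≤ p) (hcard : p ≤ Fintype.card α) {w x y z : α}
    (h : [w, x, y, z].Nodup) :
    ∃ c : Perm α, c.cycleType = {p} ∧ c w = x ∧ c x = y ∧ c y = z := by
  obtain ⟨s, hs, hsp⟩ := exists_subset_card_eq (s := ([w, x, y, z].toFinset)ᶜ) (n := p - 4) (by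
    rw [card_compl, List.toFinset_card_of_nodup h, List.length_cons, List.length_cons,
      List.length_cons, List.length_singleton]
    lia)
  set l := w :: x :: y :: z :: s.toList with hl
  have hnodup : l.Nodup := by
    change ([w, x, y, z] ++ s.toList).Nodup
    refine List.nodup_append'.2 ⟨h, s.nodup_toList, fun a ha has ↦ ?_⟩
    exact mem_compl.1 (hs (mem_toList.1 has)) (List.mem_toFinset.2 ha)
  have hlen : l.length = p := by simp [hl, hsp]; lia
  refine ⟨l.formPerm, ?_, ?_, ?_, ?_⟩
  · rw [(List.isCycle_formPerm hnodup (by lia)).cycleType,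
      List.support_formPerm_of_nodup _ hnodup (by grind), List.toFinset_card_of_nodup hnodup, hlen]
  · exact List.formPerm_apply_lt_getElem l hnodup 0 (by lia)
  · exact List.formPerm_apply_lt_getElem l hnodup 1 (by lia)
  · exact List.formPerm_apply_lt_getElem l hnodup 2 (by lia)

/-- A family of vectors indexed by pairs of distinct letters (the diagonal being set to zero),
permuted by the even permutations. -/
structure IsPairFamily (ρ : Representation K (Perm α) V) (e : α → α → V) : Prop where
  apply : ∀ g, sign g = 1 → ∀ x y, ρ g (e x y) = e (g x) (g y)
  diagonal : ∀ x, e x x = 0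

namespace IsPairFamily

variable {e : α → α → V} {p : ℕ}

theorem flip (he : IsPairFamily ρ e) : IsPairFamily ρ fun x y ↦ e y x :=
  ⟨fun g hg x y ↦ he.apply g hg y x, he.diagonal⟩

theorem sum_apply_eq_zero (he : IsPairFamily ρ e) (hodd : Odd p) (hp : 2 ≤ p)
    (hcard : p < Fintype.card α) (hfree : CyclesFixNoVector ρ p) (x : α) : ∑ y, e x y = 0 := by
  obtain ⟨c, hc, hcx⟩ : ∃ c : Perm α, c.cycleType = {p} ∧ c x = x := by
    obtain ⟨c, hc⟩ := (exists_with_cycleType_iff {y // y ≠ x} (m := {p})).2 (by simp; lia)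
    exact ⟨ofSubtype c, by rw [cycleType_ofSubtype, hc], ofSubtype_apply_of_not_mem c (by simp)⟩
  refine hfree c hc _ ?_
  rw [map_sum]
  refine Fintype.sum_equiv c _ _ fun y ↦ ?_
  rw [he.apply c (sign_eq_one_of_cycleType_eq_singleton hodd hc), hcx]

theorem sum_cycle_eq_zero (he : IsPairFamily ρ e) (hodd : Odd p) (hfree : CyclesFixNoVector ρ p)
    {c : Perm α} (hc : c.cycleType = {p}) : ∑ x ∈ c.support, e x (c x) = 0 := by
  refine hfree c hc _ ?_
  rw [map_sum]
  exact sum_equiv c (by simp) fun x _ ↦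
    he.apply c (sign_eq_one_of_cycleType_eq_singleton hodd hc) x (c x)

/-- Compare the sums along the cycles `⋯ w x y z ⋯` and `⋯ w y x z ⋯`. -/
theorem path_exchange (he : IsPairFamily ρ e) (hodd : Odd p) (hp : 5 ≤ p)
    (hcard : p ≤ Fintype.card α) (hfree : CyclesFixNoVector ρ p) {w x y z : α}
    (h : [w, x, y, z].Nodup) : e w x + e x y + e y z = e w y + e y x + e x z := by
  obtain ⟨c, hc, hw, hx, hy⟩ := exists_cycle_of_path hp hcard h
  simp only [List.nodup_cons, List.mem_cons, not_or, List.not_mem_nil, not_false_eq_true] at h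
  set s := Equiv.swap x y with hs
  have hc' : (s * c * s⁻¹).cycleType = {p} := by rw [cycleType_conj, hc]
  have hsum : ∑ a ∈ c.support, e (s a) (s (c a)) = 0 := by
    rw [← he.sum_cycle_eq_zero hodd hfree hc']
    exact sum_equiv s (by simp) (by simp)
  have hwxy : {w, x, y} ⊆ c.support := by
    simp only [insert_subset_iff, singleton_subset_iff, mem_support]
    grind
  have hrest : ∑ a ∈ c.support \ {w, x, y}, e (s a) (s (c a)) =
      ∑ a ∈ c.support \ {w, x, y}, e a (c a) := by
    refine sum_congr rfl fun a ha ↦ ?_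
    simp only [mem_sdiff, mem_insert, mem_singleton, not_or] at ha
    rw [hs, swap_apply_of_ne_of_ne ha.2.2.1 ha.2.2.2, swap_apply_of_ne_of_ne]
    · exact fun h ↦ ha.2.1 (c.injective (h.trans hw.symm))
    · exact fun h ↦ ha.2.2.1 (c.injective (h.trans hx.symm))
  have hsum' := he.sum_cycle_eq_zero hodd hfree hc
  rw [← sum_sdiff hwxy] at hsum hsum'
  rw [hrest, ← hsum', add_left_cancel_iff, sum_insert (by grind), sum_insert (by grind),
    sum_singleton, sum_insert (by grind), sum_insert (by grind), sum_singleton, hw, hx, hy, hs,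
    swap_apply_left, swap_apply_right, swap_apply_of_ne_of_ne (by grind) (by grind),
    swap_apply_of_ne_of_ne (by grind) (by grind), ← add_assoc, ← add_assoc] at hsum
  exact hsum.symm

theorem sum_compl_eq (he : IsPairFamily ρ e) (hodd : Odd p) (hp : 2 ≤ p)
    (hcard : p < Fintype.card α) (hfree : CyclesFixNoVector ρ p) (s : Finset α) (x : α) :
    ∑ y ∈ sᶜ, e x y = -∑ y ∈ s, e x y := by
  rw [eq_neg_iff_add_eq_zero, sum_compl_add_sum, he.sum_apply_eq_zero hodd hp hcard hfree]

theorem path_exchange_sum (he : IsPairFamily ρ e) (hodd : Odd p) (hp : 5 ≤ p)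
    (hcard : p < Fintype.card α) (hfree : CyclesFixNoVector ρ p) {w x y : α} (hwx : w ≠ x)
    (hwy : w ≠ y) (hxy : x ≠ y) :
    ((Fintype.card α : ℤ) - 3) • (e w x + e x y - e w y - e y x) =
      e y w + e y x - e x w - e x y := by
  have hz (z : α) (hz : z ∈ ({w, x, y} : Finset α)ᶜ) :
      e w x + e x y - e w y - e y x = e x z - e y z := by
    simp only [mem_compl, mem_insert, mem_singleton, not_or] at hz
    have hpath := he.path_exchange hodd hp hcard.le hfree (w := w) (x := x) (y := y) (z := z)
      (by simp [*, Ne.symm])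
    linear_combination (norm := module) hpath
  have hsum := sum_congr rfl hz
  rw [sum_const, sum_sub_distrib, he.sum_compl_eq hodd (by lia) hcard hfree,
    he.sum_compl_eq hodd (by lia) hcard hfree, card_compl,
    card_eq_three.2 ⟨w, x, y, hwx, hwy, hxy, rfl⟩, ← natCast_zsmul, Nat.cast_sub (by lia),
    sum_insert (by simp [*]), sum_pair hxy, sum_insert (by simp [*]), sum_pair hxy, he.diagonal,
    he.diagonal] at hsum
  linear_combination (norm := module) hsum

theorem comm [CharZero K] (he : IsPairFamily ρ e) (hodd : Odd p) (hp : 5 ≤ p)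
    (hcard : p < Fintype.card α) (hfree : CyclesFixNoVector ρ p) (x y : α) : e x y = e y x := by
  obtain rfl | hxy := eq_or_ne x y
  · rfl
  have hw (w : α) (hw : w ∈ ({x, y} : Finset α)ᶜ) :
      ((Fintype.card α : ℤ) - 3) • (e w x - e w y + (e x y - e y x)) =
        e y w - e x w + (e y x - e x y) := by
    simp only [mem_compl, mem_insert, mem_singleton, not_or] at hw
    linear_combination (norm := module) he.path_exchange_sum hodd hp hcard hfree hw.1 hw.2 hxy
  have hrow (z : α) : ∑ w ∈ ({x, y} : Finset α)ᶜ, e z w = -(e z x + e z y) := by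
    rw [he.sum_compl_eq hodd (by lia) hcard hfree, sum_pair hxy]
  have hcol (z : α) : ∑ w ∈ ({x, y} : Finset α)ᶜ, e w z = -(e x z + e y z) := by
    rw [he.flip.sum_compl_eq hodd (by lia) hcard hfree, sum_pair hxy]
  have hsum := sum_congr rfl hw
  simp only [← smul_sum, sum_add_distrib, sum_sub_distrib, hrow, hcol, sum_const, card_compl,
    card_pair hxy, he.diagonal, ← natCast_zsmul, Nat.cast_sub (show 2 ≤ Fintype.card α by lia)]
    at hsum
  have hmul : (((Fintype.card α : ℤ) - 3) * Fintype.card α) • (e x y - e y x) = 0 := by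
    linear_combination (norm := module) hsum
  rw [← Int.cast_smul_eq_zsmul K] at hmul
  refine sub_eq_zero.1 ((smul_eq_zero_iff_right (Int.cast_ne_zero.2 ?_)).1 hmul)
  exact mul_ne_zero (by lia) (by lia)

theorem eq_zero [CharZero K] (he : IsPairFamily ρ e) (hodd : Odd p) (hp : 5 ≤ p)
    (hcard : p < Fintype.card α) (hfree : CyclesFixNoVector ρ p) : e = 0 := by
  have hcomm := he.comm hodd hp hcard hfree
  have hconst (w x y : α) (hx : w ≠ x) (hy : w ≠ y) : e w x = e w y := by
    obtain rfl | hxy := eq_or_ne x y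
    · rfl
    have h := he.path_exchange_sum hodd hp hcard hfree hx hy hxy
    rw [hcomm y x, hcomm y w, hcomm x w] at h
    have hmul : ((Fintype.card α : ℤ) - 2) • (e w x - e w y) = 0 := by
      linear_combination (norm := module) h
    rw [← Int.cast_smul_eq_zsmul K] at hmul
    exact sub_eq_zero.1 ((smul_eq_zero_iff_right (Int.cast_ne_zero.2 (by lia))).1 hmul)
  ext w x
  obtain rfl | hwx := eq_or_ne w x
  · exact he.diagonal w
  have hsum := he.sum_apply_eq_zero hodd (by lia) hcard hfree w
  rw [← sum_compl_add_sum {w}, sum_singleton, he.diagonal, add_zero,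
    sum_eq_card_nsmul (b := e w x) fun y hy ↦ hconst w y x (by simpa [eq_comm] using hy) hwx,
    card_compl, card_singleton, ← Nat.cast_smul_eq_nsmul K] at hsum
  exact (smul_eq_zero_iff_right (Nat.cast_ne_zero.2 (by lia))).1 hsum

end IsPairFamily

theorem exists_isPairFamily {x y : α} (hxy : x ≠ y) {v : V} (hv0 : v ≠ 0) [CharZero K]
    (hv : ∀ g : Perm α, sign g = 1 → g x = x → g y = y → ρ g v = v) :
    ∃ e ≠ 0, IsPairFamily ρ e := by
  let e (a b : α) : V := ∑ g : Perm α with sign g = 1 ∧ g x = a ∧ g y = b, ρ g v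
  refine ⟨e, fun he ↦ ?_, fun h hh a b ↦ ?_, fun a ↦ ?_⟩
  · have hxy0 : e x y = #{g : Perm α | sign g = 1 ∧ g x = x ∧ g y = y} • v := by
      refine sum_eq_card_nsmul fun g hg ↦ ?_
      obtain ⟨hsign, hx, hy⟩ := mem_filter_univ g |>.1 hg
      exact hv g hsign hx hy
    rw [he, Pi.zero_apply, Pi.zero_apply, ← Nat.cast_smul_eq_nsmul K] at hxy0
    exact smul_ne_zero (Nat.cast_ne_zero.2 (card_ne_zero_of_mem (a := 1) (by simp))) hv0
      hxy0.symm
  · rw [map_sum]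
    refine sum_equiv (Equiv.mulLeft h) (fun g ↦ ?_) fun g _ ↦ ?_
    · simp [hh, Perm.sign_mul]
    · rw [coe_mulLeft, map_mul, Module.End.mul_apply]
  · refine sum_eq_zero fun g hg ↦ ?_
    simp only [mem_filter_univ] at hg
    exact absurd (g.injective (hg.2.1.trans hg.2.2.symm)) hxy

theorem CyclesFixNoVector.comp_ofSubtype {ℓ : ℕ} (hfree : CyclesFixNoVector ρ ℓ) (q : α → Prop)
    [DecidablePred q] [Fintype (Subtype q)] :
    CyclesFixNoVector (ρ.comp (ofSubtype : Perm (Subtype q) →* Perm α)) ℓ :=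
  fun g hg ↦ hfree (ofSubtype g) (by rw [cycleType_ofSubtype, hg])

theorem not_cyclesFixNoVector_of_card_eq_succ [CharZero K] [Nontrivial V] {p : ℕ} (hp : p.Prime)
    (hp5 : 5 ≤ p) (hcard : Fintype.card α = p + 1) : ¬CyclesFixNoVector ρ p := by
  intro hfree
  have hodd : Odd p := hp.odd_of_ne_two (by lia)
  obtain ⟨y⟩ := Fintype.card_pos_iff.1 (show 0 < Fintype.card α by lia)
  have hp' : Fintype.card {z // z ≠ y} = p := by simp [hcard]
  obtain ⟨x, v, hv0, hv⟩ := exists_fixed_of_cyclesFixNoVector (hp'.symm ▸ hp) (hp'.symm ▸ hodd)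
    (hp'.symm ▸ hfree.comp_ofSubtype (· ≠ y))
  have hfixed (g : Perm α) (hg : sign g = 1) (hx : g x = x) (hy : g y = y) : ρ g v = v := by
    have hmem (z : α) : g z ≠ y ↔ z ≠ y := by
      rw [not_iff_not, ← hy, g.apply_eq_iff_eq, hy]
    have hmoved (z : α) (hz : g z ≠ z) : z ≠ y := by
      rintro rfl
      exact hz hy
    have h := hv (g.subtypePerm hmem) (by rw [sign_subtypePerm g hmem hmoved, hg]) (Subtype.ext hx)
    rwa [MonoidHom.comp_apply, ofSubtype_subtypePerm hmem hmoved] at h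
  obtain ⟨e, he0, he⟩ := exists_isPairFamily x.2 hv0 hfixed
  exact he0 (he.eq_zero hodd hp5 (by lia) hfree)

theorem not_cyclesFixNoVector_of_lt_card [CharZero K] [Nontrivial V] {p : ℕ} (hp : p.Prime)
    (hp5 : 5 ≤ p) (hcard : p < Fintype.card α) : ¬CyclesFixNoVector ρ p := by
  obtain ⟨s, -, hs⟩ := exists_subset_card_eq (s := (univ : Finset α)) (n := p + 1) hcard
  exact fun hfree ↦ not_cyclesFixNoVector_of_card_eq_succ hp hp5 (by simpa)
    (hfree.comp_ofSubtype (· ∈ s))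

end PrimeCycles

section KleinFour

variable {α K V : Type*} [Fintype α] [DecidableEq α] [Field K] [CharZero K] [AddCommGroup V]
  [Module K V] {ρ : Representation K (Perm α) V}

theorem not_commute_of_isThreeCycle (hα : Fintype.card α = 4) {c g : Perm α}
    (hc : c.IsThreeCycle) (hg : g.cycleType = {2, 2}) : ¬Commute c g := by
  intro h
  have hsupp : c.supportᶜ.card = 1 := by rw [card_compl, hα, hc.card_support]
  obtain ⟨x, hx⟩ := card_eq_one.mp hsupp
  have hfix (y : α) : c y = y ↔ y = x := by
    rw [← notMem_support, ← mem_compl, hx, mem_singleton]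
  have hgx : g x = x := by
    rw [← hfix, ← mul_apply, h.eq, mul_apply, (hfix x).mpr rfl]
  have hgs : g.support = univ := by
    rw [← card_eq_iff_eq_univ, ← sum_cycleType, hg, hα]; rfl
  exact notMem_support.mpr hgx (hgs ▸ mem_univ x)

theorem isThreeCycle_or_cycleType_eq_two_two (hα : Fintype.card α = 4) {g : Perm α}
    (hg : sign g = 1) (hg1 : g ≠ 1) : g.IsThreeCycle ∨ g.cycleType = {2, 2} := by
  have hle : g.cycleType.sum ≤ 4 := by rw [sum_cycleType, ← hα]; exact g.support.card_le_univ
  by_cases h3 : 3 ∈ g.cycleType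
  · obtain ⟨m, hm⟩ := Multiset.exists_cons_of_mem h3
    rcases m.empty_or_exists_mem with rfl | ⟨k, hk⟩
    · exact .inl hm
    · have hk2 := two_le_of_mem_cycleType (σ := g) (hm ▸ Multiset.mem_cons_of_mem hk)
      have := Multiset.le_sum_of_mem hk
      rw [hm, Multiset.sum_cons] at hle
      omega
  · refine .inr <| (alternatingGroup.mem_kleinFour_of_order_two_pow (n := 2)
      (by rwa [Nat.card_eq_fintype_card]) (mem_alternatingGroup.mpr hg) ?_).resolve_left
      (mt cycleType_eq_zero.mp hg1)
    rw [← lcm_cycleType, Multiset.lcm_dvd]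
    intro k hk
    have hk2 := two_le_of_mem_cycleType hk
    have hk4 := (Multiset.le_sum_of_mem hk).trans hle
    have hk3 : k ≠ 3 := by rintro rfl; exact h3 hk
    interval_cases k <;> simp_all

theorem apply_eq_of_cycleType_eq_two_two_of_card_eq_four (hα : Fintype.card α = 4)
    (hfree : CyclesFixNoVector ρ 3) {g : Perm α} (hg : g.cycleType = {2, 2}) (v : V) :
    ρ g v = v := by
  have hα' : Nat.card α = 4 := by rwa [Nat.card_eq_fintype_card]
  have hnormal := alternatingGroup.normal_kleinFour hα'
  have hmem (k : alternatingGroup α) :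
      k ∈ alternatingGroup.kleinFour α ↔ k = 1 ∨ (k : Perm α).cycleType = {2, 2} := by
    rw [← SetLike.mem_coe, alternatingGroup.coe_kleinFour_of_card_eq_four hα']; rfl
  obtain ⟨c, hc⟩ := (exists_with_cycleType_iff α (m := {3})).mpr ⟨by simp [hα], by simp⟩
  have h3 : c.IsThreeCycle := hc
  have hgmem : g ∈ alternatingGroup α := by
    rw [mem_alternatingGroup, sign_of_cycleType, hg]; decide
  have horder : orderOf (⟨c, h3.mem_alternatingGroup⟩ : alternatingGroup α) = 3 := by
    rw [Subgroup.orderOf_mk, h3.orderOf]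
  refine apply_eq_of_fixedPointFree (ρ := ρ.comp (alternatingGroup α).subtype)
    (n := ⟨g, hgmem⟩) (by rw [horder]; exact Nat.prime_three) (fun k hk hck ↦ ?_)
    (hfree c hc) ((hmem _).mpr (.inr hg)) v
  exact ((hmem k).mp hk).resolve_right fun h ↦
    not_commute_of_isThreeCycle hα h3 h (congrArg Subtype.val hck.eq)

theorem apply_eq_of_cycleType_eq_two_two (hfree : CyclesFixNoVector ρ 3) {g : Perm α}
    (hg : g.cycleType = {2, 2}) (v : V) : ρ g v = v := by
  obtain ⟨h, hh⟩ := (mem_range_ofSubtype_iff (p := (· ∈ g.support))).mpr fun x hx ↦ hx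
  rw [← hh]
  refine apply_eq_of_cycleType_eq_two_two_of_card_eq_four
    (ρ := ρ.comp (ofSubtype : Perm {x // x ∈ g.support} →* Perm α)) ?_
    (hfree.comp_ofSubtype _) ?_ v
  · rw [Fintype.card_coe, ← sum_cycleType, hg]; rfl
  · rwa [← cycleType_ofSubtype, hh]

theorem not_cyclesFixNoVector_three [Nontrivial V] (hα : 5 ≤ Fintype.card α) :
    ¬CyclesFixNoVector ρ 3 := by
  intro hfree
  obtain ⟨c, hc⟩ := (exists_with_cycleType_iff α (m := {3})).mpr ⟨by simp; omega, by simp⟩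
  have h3 : c.IsThreeCycle := hc
  have hmem : c ∈ Subgroup.closure {g : Perm α | g.cycleType = {2, 2}} := by
    rw [closure_cycleType_eq_two_two_eq_alternatingGroup (by rwa [Nat.card_eq_fintype_card])]
    exact h3.mem_alternatingGroup
  have hle : Subgroup.closure {g : Perm α | g.cycleType = {2, 2}} ≤ ρ.ker :=
    (Subgroup.closure_le _).mpr fun g hg ↦
      LinearMap.ext (apply_eq_of_cycleType_eq_two_two hfree hg)
  obtain ⟨v, hv⟩ := exists_ne (0 : V)
  exact hv (hfree c hc v (by rw [MonoidHom.mem_ker.mp (hle hmem), Module.End.one_apply]))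

end KleinFour

section EvenCentralizer

variable {α K V : Type*} [Fintype α] [DecidableEq α] [Field K] [AddCommGroup V] [Module K V]
  {ρ : Representation K (Perm α) V} {c : Perm α}

/-- Some nonzero vector is fixed by the centralizer of `g` in the alternating group. -/
def FixedByEvenCentralizer (ρ : Representation K (Perm α) V) (g : Perm α) : Prop :=
  ∃ v ≠ 0, ∀ τ, sign τ = 1 → Commute τ g → ρ τ v = v

theorem disjoint_ofSubtype_notMem_support (σ : Perm {x // x ∉ c.support}) :
    Disjoint c (ofSubtype σ) := fun x ↦ by
  by_cases hx : x ∈ c.support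
  · exact .inr (ofSubtype_apply_of_not_mem σ (by simpa using hx))
  · exact .inl (notMem_support.mp hx)

theorem exists_eq_zpow_mul_ofSubtype (hc : c.IsCycle) {τ : Perm α} (hτ : Commute τ c) :
    ∃ (i : ℤ) (σ : Perm {x // x ∉ c.support}), τ = c ^ i * ofSubtype σ := by
  obtain ⟨hs, i, hi⟩ := hc.commute_iff.mp hτ
  obtain ⟨σ, hσ⟩ := (mem_range_ofSubtype_iff (p := (· ∉ c.support)) (g := c ^ (-i) * τ)).mpr
    fun x hx hxc ↦ by
      refine mem_support.mp hx ?_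
      have hix : (c ^ i) x = τ x :=
        (Perm.congr_fun hi x).trans (ofSubtype_subtypePerm_of_mem hs hxc)
      rw [mul_apply, ← hix, ← mul_apply, ← zpow_add, neg_add_cancel, zpow_zero, one_apply]
  exact ⟨i, σ, by rw [hσ, ← mul_assoc, ← zpow_add, add_neg_cancel, zpow_zero, one_mul]⟩

theorem commute_of_commute_mul_ofSubtype (hc : c.IsCycle) {h : Perm {x // x ∉ c.support}}
    (hh : #c.support ∉ h.cycleType) {τ : Perm α} (hτ : Commute τ (c * ofSubtype h)) :
    Commute τ c := by
  have hfactors :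
      (c * ofSubtype h).cycleFactorsFinset = {c} ∪ (ofSubtype h).cycleFactorsFinset := by
    rw [(disjoint_ofSubtype_notMem_support h).cycleFactorsFinset_mul_eq_union,
      cycleFactorsFinset_eq_singleton_self_iff.mpr hc]
  have hmem : τ * c * τ⁻¹ ∈ (c * ofSubtype h).cycleFactorsFinset := by
    rw [← mul_inv_eq_iff_eq_mul.mpr hτ.eq, mem_cycleFactorsFinset_conj, hfactors]
    exact mem_union_left _ (mem_singleton_self c)
  rw [hfactors, mem_union, mem_singleton] at hmem
  rcases hmem with heq | hmem
  · exact mul_inv_eq_iff_eq_mul.mp heq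
  · refine (hh ?_).elim
    rw [← cycleType_ofSubtype, cycleType_def]
    exact Multiset.mem_map.mpr ⟨_, hmem, by simp⟩

/-- The permutations of the points fixed by `c` act on the vectors fixed by `c`. -/
def fixedRep (ρ : Representation K (Perm α) V) (c : Perm α) :
    Representation K (Perm {x // x ∉ c.support}) (fixedSubmodule ρ c) where
  toFun σ := (ρ (ofSubtype σ)).restrict (p := fixedSubmodule ρ c) fun v hv ↦ by
    rw [mem_fixedSubmodule] at hv ⊢
    rw [← Module.End.mul_apply, ← map_mul, (disjoint_ofSubtype_notMem_support σ).commute.eq,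
      map_mul, Module.End.mul_apply, hv]
  map_one' := by ext; simp
  map_mul' σ τ := by ext; simp

theorem coe_fixedRep_apply (σ : Perm {x // x ∉ c.support}) (v : fixedSubmodule ρ c) :
    (fixedRep ρ c σ v : V) = ρ (ofSubtype σ) v := rfl

theorem FixedByEvenCentralizer.mul_ofSubtype (hc : c.IsCycle) (hodd : Odd #c.support)
    {h : Perm {x // x ∉ c.support}} (hh : #c.support ∉ h.cycleType)
    (hfix : FixedByEvenCentralizer (fixedRep ρ c) h) :
    FixedByEvenCentralizer ρ (c * ofSubtype h) := by
  obtain ⟨⟨v, hv⟩, hv0, hfix⟩ := hfix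
  refine ⟨v, fun h0 ↦ hv0 (Subtype.ext h0), fun τ hτ hcomm ↦ ?_⟩
  have hτc := commute_of_commute_mul_ofSubtype hc hh hcomm
  obtain ⟨i, σ, rfl⟩ := exists_eq_zpow_mul_ofSubtype hc hτc
  have hsign : sign σ = 1 := by
    have hsc : sign c = 1 := by rw [hc.sign, hodd.neg_one_pow, neg_neg]
    rwa [map_mul, map_zpow, hsc, one_zpow, one_mul, sign_ofSubtype] at hτ
  have hσh : Commute σ h := by
    have hzpow := ((disjoint_ofSubtype_notMem_support h).commute.zpow_left i)
    have hτh := hτc.inv_right.mul_right hcomm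
    rw [inv_mul_cancel_left] at hτh
    have := hzpow.inv_left.mul_left hτh
    rw [inv_mul_cancel_left] at this
    exact ofSubtype_injective (by simpa only [map_mul] using this.eq)
  have hσv := congrArg Subtype.val (hfix σ hsign hσh)
  rw [coe_fixedRep_apply] at hσv
  rw [map_mul, Module.End.mul_apply, hσv, zpow_apply_of_fixed (mem_fixedSubmodule.mp hv)]

theorem fixedByEvenCentralizer_of_card_le_two [Nontrivial V] (hα : Fintype.card α ≤ 2)
    (g : Perm α) : FixedByEvenCentralizer ρ g := by
  obtain ⟨v, hv⟩ := exists_ne (0 : V)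
  refine ⟨v, hv, fun τ hτ _ ↦ ?_⟩
  rw [← mem_alternatingGroup, alternatingGroup.eq_bot_of_card_le_two
    (by rwa [Nat.card_eq_fintype_card]), Subgroup.mem_bot] at hτ
  rw [hτ, map_one, Module.End.one_apply]

theorem card_notMem_support (c : Perm α) :
    Fintype.card {x // x ∉ c.support} = Fintype.card α - #c.support := by
  rw [Fintype.card_subtype_compl, Fintype.card_coe]

theorem fixedByEvenCentralizer_of_isCycle (hc : c.IsCycle) (hodd : Odd #c.support)
    (hcard : Fintype.card α ≤ #c.support + 2) {v : V} (hv : v ≠ 0) (h : ρ c v = v) :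
    FixedByEvenCentralizer ρ c := by
  have := nontrivial_fixedSubmodule hv h
  have hone : FixedByEvenCentralizer (fixedRep ρ c) 1 :=
    fixedByEvenCentralizer_of_card_le_two (by rw [card_notMem_support]; omega) 1
  simpa using hone.mul_ofSubtype hc hodd (by simp)

end EvenCentralizer

section PrimeRecursion

theorem exists_prime_half_lt {n : ℕ} (hn : 6 ≤ n) :
    ∃ p, p.Prime ∧ 5 ≤ p ∧ p < n ∧ n < 2 * p ∧ (n = p + 3 → 7 ≤ p) := by
  by_cases h8 : n = 8
  · exact ⟨7, by norm_num, by omega⟩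
  obtain ⟨p, hp, h1, h2⟩ := Nat.exists_prime_lt_and_le_two_mul (n / 2) (by omega)
  have hodd := Nat.odd_iff.mp (hp.odd_of_ne_two (by omega))
  have h4 : p ≠ 4 := by rintro rfl; omega
  exact ⟨p, hp, by omega, by omega, by omega, by omega⟩

variable {α K V : Type*} [Fintype α] [DecidableEq α] [Field K] [AddCommGroup V] [Module K V]
  {ρ : Representation K (Perm α) V} {c : Perm α} {ℓ : ℕ}

theorem isCycle_of_cycleType_eq_singleton (hc : c.cycleType = {ℓ}) : c.IsCycle :=
  card_cycleType_eq_one.mp (by rw [hc, Multiset.card_singleton])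

theorem card_support_of_cycleType_eq_singleton (hc : c.cycleType = {ℓ}) : #c.support = ℓ := by
  rw [← sum_cycleType, hc, Multiset.sum_singleton]

theorem exists_fixed_of_not_cyclesFixNoVector (h : ¬CyclesFixNoVector ρ ℓ) :
    ∃ c : Perm α, c.cycleType = {ℓ} ∧ ∃ v ≠ 0, ρ c v = v := by
  simp only [CyclesFixNoVector] at h
  push Not at h
  obtain ⟨c, hc, v, hcv, hv⟩ := h
  exact ⟨c, hc, v, hv, hcv⟩

theorem fixedByEvenCentralizer_of_cycleType_eq_singleton (hc : c.cycleType = {ℓ}) (hodd : Odd ℓ)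
    (hcard : Fintype.card α ≤ ℓ + 2) {v : V} (hv : v ≠ 0) (h : ρ c v = v) :
    FixedByEvenCentralizer ρ c := by
  have hsupp := card_support_of_cycleType_eq_singleton hc
  exact fixedByEvenCentralizer_of_isCycle (isCycle_of_cycleType_eq_singleton hc)
    (by rwa [hsupp]) (by rwa [hsupp]) hv h

theorem exists_fixedByEvenCentralizer_of_fixedRep (hc : c.cycleType = {ℓ}) (hodd : Odd ℓ)
    {h : Perm {x // x ∉ c.support}} (hh : sign h = 1) (hℓ : ℓ ∉ h.cycleType)
    (hfix : FixedByEvenCentralizer (fixedRep ρ c) h) :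
    ∃ g : Perm α, sign g = 1 ∧ FixedByEvenCentralizer ρ g := by
  have hsupp := card_support_of_cycleType_eq_singleton hc
  refine ⟨c * ofSubtype h, ?_, hfix.mul_ofSubtype (isCycle_of_cycleType_eq_singleton hc)
    (by rwa [hsupp]) (by rwa [hsupp])⟩
  rw [map_mul, sign_ofSubtype, hh, mul_one, sign_eq_one_of_cycleType_eq_singleton hodd hc]

variable [CharZero K] [Nontrivial V]

theorem exists_fixedByEvenCentralizer_of_prime (hp : (Fintype.card α).Prime)
    (hp5 : 5 ≤ Fintype.card α) : ∃ c : Perm α, ∃ ℓ, c.cycleType = {ℓ} ∧ Odd ℓ ∧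
      Fintype.card α ≤ ℓ + 2 ∧ FixedByEvenCentralizer ρ c := by
  have hodd := hp.odd_of_ne_two (by omega)
  suffices ∃ c : Perm α, ∃ ℓ, c.cycleType = {ℓ} ∧ Odd ℓ ∧ Fintype.card α ≤ ℓ + 2 ∧
      ∃ v ≠ 0, ρ c v = v by
    obtain ⟨c, ℓ, hc, hℓ, hcard, v, hv, hcv⟩ := this
    exact ⟨c, ℓ, hc, hℓ, hcard,
      fixedByEvenCentralizer_of_cycleType_eq_singleton hc hℓ hcard hv hcv⟩
  by_cases hfree : CyclesFixNoVector ρ (Fintype.card α)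
  · obtain ⟨x, v, hv, hfix⟩ := exists_fixed_of_cyclesFixNoVector hp hodd hfree
    have hℓ : Odd (Fintype.card α - 2) := Nat.Odd.sub_even (by omega) hodd even_two
    obtain ⟨c, hc⟩ := (exists_with_cycleType_iff {y // y ≠ x} (m := {Fintype.card α - 2})).mpr
      ⟨by simp; omega, by simp; omega⟩
    rw [← cycleType_ofSubtype] at hc
    exact ⟨ofSubtype c, _, hc, hℓ, by omega, v, hv,
      hfix _ (sign_eq_one_of_cycleType_eq_singleton hℓ hc) (ofSubtype_apply_of_not_mem c (by simp))⟩
  · obtain ⟨c, hc, hcv⟩ := exists_fixed_of_not_cyclesFixNoVector hfree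
    exact ⟨c, _, hc, hodd, by omega, hcv⟩

theorem exists_fixedByEvenCentralizer_of_card_eq_prime_add_three {p : ℕ} (hp : p.Prime)
    (hp7 : 7 ≤ p) (hα : Fintype.card α = p + 3) :
    ∃ g : Perm α, sign g = 1 ∧ FixedByEvenCentralizer ρ g := by
  obtain ⟨c, hc, v, hv, hcv⟩ :=
    exists_fixed_of_not_cyclesFixNoVector (not_cyclesFixNoVector_three (ρ := ρ) (by omega))
  have := nontrivial_fixedSubmodule hv hcv
  have hcard : Fintype.card {x // x ∉ c.support} = p := by
    rw [card_notMem_support, card_support_of_cycleType_eq_singleton hc]; omega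
  obtain ⟨h, ℓ, hh, hℓ, hle, hfix⟩ := exists_fixedByEvenCentralizer_of_prime (ρ := fixedRep ρ c)
    (by rwa [hcard]) (by omega)
  refine exists_fixedByEvenCentralizer_of_fixedRep hc (by decide)
    (sign_eq_one_of_cycleType_eq_singleton hℓ hh) ?_ hfix
  rw [hh, Multiset.mem_singleton]
  omega

theorem exists_fixedByEvenCentralizer_of_card_le_five (hα : Fintype.card α ≤ 5)
    (hα3 : Fintype.card α ≠ 3) : ∃ g : Perm α, sign g = 1 ∧ FixedByEvenCentralizer ρ g := by
  by_cases hα2 : Fintype.card α ≤ 2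
  · exact ⟨1, map_one _, fixedByEvenCentralizer_of_card_le_two hα2 1⟩
  by_cases hfree : CyclesFixNoVector ρ 3
  · have hα4 : Fintype.card α = 4 := by
      by_contra
      exact not_cyclesFixNoVector_three (ρ := ρ) (by omega) hfree
    obtain ⟨g, hg⟩ := (exists_with_cycleType_iff α (m := {2, 2})).mpr ⟨by simp [hα4], by simp⟩
    obtain ⟨v, hv⟩ := exists_ne (0 : V)
    refine ⟨g, by rw [sign_of_cycleType, hg]; decide, v, hv, fun τ hτ hcomm ↦ ?_⟩
    rcases eq_or_ne τ 1 with rfl | hτ1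
    · rw [map_one, Module.End.one_apply]
    · exact apply_eq_of_cycleType_eq_two_two hfree
        ((isThreeCycle_or_cycleType_eq_two_two hα4 hτ hτ1).resolve_left
          fun h3 ↦ not_commute_of_isThreeCycle hα4 h3 hg hcomm) v
  · obtain ⟨c, hc, v, hv, hcv⟩ := exists_fixed_of_not_cyclesFixNoVector hfree
    exact ⟨c, sign_eq_one_of_cycleType_eq_singleton (by decide) hc,
      fixedByEvenCentralizer_of_cycleType_eq_singleton hc (by decide) hα hv hcv⟩

end PrimeRecursion

theorem exists_fixedByEvenCentralizer {K : Type*} [Field K] [CharZero K] {n : ℕ} (hn : n ≠ 3) :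
    ∀ {α V : Type*} [Fintype α] [DecidableEq α] [AddCommGroup V] [Module K V] [Nontrivial V]
      (ρ : Representation K (Perm α) V),
      Fintype.card α = n → ∃ g : Perm α, sign g = 1 ∧ FixedByEvenCentralizer ρ g := by
  induction n using Nat.strong_induction_on with
  | _ n ih =>
  intro α V _ _ _ _ _ ρ hα
  by_cases h5 : n ≤ 5
  · exact exists_fixedByEvenCentralizer_of_card_le_five (hα.trans_le h5) (hα.trans_ne hn)
  obtain ⟨p, hp, hp5, hpn, hnp, hp7⟩ := exists_prime_half_lt (show 6 ≤ n by omega)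
  by_cases hn3 : n = p + 3
  · exact exists_fixedByEvenCentralizer_of_card_eq_prime_add_three hp (hp7 hn3) (hα.trans hn3)
  obtain ⟨c, hc, v, hv, hcv⟩ := exists_fixed_of_not_cyclesFixNoVector
    (not_cyclesFixNoVector_of_lt_card (ρ := ρ) hp hp5 (by omega))
  have := nontrivial_fixedSubmodule hv hcv
  have hcard : Fintype.card {x // x ∉ c.support} = n - p := by
    rw [card_notMem_support, card_support_of_cycleType_eq_singleton hc, hα]
  obtain ⟨h, hh, hfix⟩ := ih (n - p) (by omega) (by omega) (fixedRep ρ c) hcard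
  refine exists_fixedByEvenCentralizer_of_fixedRep hc (hp.odd_of_ne_two (by omega)) hh
    (fun hmem ↦ ?_) hfix
  have hle : p ≤ #h.support := sum_cycleType h ▸ Multiset.le_sum_of_mem hmem
  have := h.support.card_le_univ
  omega

section ConjugationRepresentations

open Representation TensorProduct

variable {G : Type*} [Group G]

theorem conjRepOn_single (H : Subgroup G) [H.Normal] (g : G) (x : H) (c : ℂ) :
    conjRepOn H g (.single x c) = .single (MulAut.conjNormal g x) c := by
  simp [conjRepOn]

theorem conjRep_single (g x : G) (c : ℂ) :
    conjRep G g (.single x c) = .single (g * x * g⁻¹) c := by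
  simp [conjRep]

theorem conjRep_eq_comp_subtype (H : Subgroup G) [H.Normal] :
    conjRep H = (conjRepOn H).comp H.subtype := by
  rw [conjRepOn, MonoidHom.comp_assoc, conjRep]
  congr 1
  ext g x
  rfl

theorem character_conjRepOn [Finite G] (H : Subgroup G) [H.Normal] (g : G) :
    (conjRepOn H).character g = Nat.card {x : H // Commute (x : G) g} := by
  classical
  cases nonempty_fintype H
  have hfix (x : H) : MulAut.conjNormal g x = x ↔ Commute (x : G) g := by
    rw [Subtype.ext_iff, MulAut.conjNormal_apply, mul_inv_eq_iff_eq_mul, commute_iff_eq, eq_comm]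
  let b : Module.Basis H ℂ (MonoidAlgebra ℂ H) := ⟨MonoidAlgebra.coeffLinearEquiv ℂ⟩
  have hb (x : H) : b x = MonoidAlgebra.single x 1 := rfl
  have hr (y : MonoidAlgebra ℂ H) : b.repr y = y.coeff := rfl
  rw [character, LinearMap.trace_eq_matrix_trace ℂ b, Matrix.trace, Nat.card_eq_fintype_card,
    Fintype.card_subtype]
  simp [LinearMap.toMatrix_apply, hb, hr, conjRepOn_single, Finsupp.single_apply, hfix]

theorem exists_intertwiningMap_conjRep_ne_zero [Finite G] {V : Type*} [AddCommGroup V] [Module ℂ V]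
    {ρ : Representation ℂ G V} {g : G} {v : V} (hv : v ≠ 0)
    (hfix : ∀ s, Commute s g → ρ s v = v) : ∃ f : ρ.IntertwiningMap (conjRep G), f ≠ 0 := by
  classical
  cases nonempty_fintype G
  obtain ⟨ℓ, hℓ⟩ : ∃ ℓ : Module.Dual ℂ V, ℓ v ≠ 0 := by
    by_contra! h
    exact hv ((Module.forall_dual_apply_eq_zero_iff ℂ v).mp h)
  let f : ρ.IntertwiningMap (conjRep G) :=
    { toLinearMap := ∑ s, MonoidAlgebra.lsingle (s * g * s⁻¹) ∘ₗ ℓ ∘ₗ ρ s⁻¹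
      isIntertwining' := fun h ↦ by
        ext1 x
        simp only [LinearMap.comp_apply, LinearMap.sum_apply, map_sum]
        exact Fintype.sum_equiv (Equiv.mulLeft h⁻¹) _ _ fun s ↦ by
          simp [conjRep_single, mul_assoc] }
  have hfv : f v = ∑ s, .single (s * g * s⁻¹) (ℓ (ρ s⁻¹ v)) := LinearMap.sum_apply _ _ v
  have hcoeff : (f v).coeff g = #{s | Commute s g} * ℓ v := by
    rw [hfv, MonoidAlgebra.coeff_sum, Finsupp.finsetSum_apply, card_filter, Nat.cast_sum, sum_mul]
    refine sum_congr rfl fun s _ ↦ ?_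
    rw [MonoidAlgebra.coeff_single, Finsupp.single_apply, mul_inv_eq_iff_eq_mul, ← commute_iff_eq]
    split_ifs with hs
    · rw [hfix _ hs.inv_left, Nat.cast_one, one_mul]
    · rw [Nat.cast_zero, zero_mul]
  refine ⟨f, fun h0 ↦ mul_ne_zero (Nat.cast_ne_zero.2 ?_) hℓ (hcoeff.symm.trans (by simp [h0]))⟩
  exact card_ne_zero_of_mem (mem_filter_univ 1 |>.2 (Commute.one_left g))

theorem omegaRep_tmul {n : ℕ} {V : Type*} [AddCommGroup V] [Module ℂ V]
    (ρ : Representation ℂ (Perm (Fin n)) V) (σ : Perm (Fin n)) (c : ℂ) (v : V) :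
    omegaRep ρ σ (c ⊗ₜ v) = c ⊗ₜ twistRep sign ρ σ v := by
  simp [omegaRep, signRep, twistRep_apply, TensorProduct.smul_tmul']

/-- Tensoring with the sign is twisting by the sign, under `ℂ ⊗ V ≃ V`. -/
noncomputable def omegaRepEquiv {n : ℕ} {V : Type*} [AddCommGroup V] [Module ℂ V]
    (ρ : Representation ℂ (Perm (Fin n)) V) : (omegaRep ρ).Equiv (twistRep sign ρ) :=
  Representation.Equiv.mk (TensorProduct.lid ℂ V) fun σ ↦ TensorProduct.ext' fun c v ↦ by
    simp [omegaRep_tmul]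

variable {n : ℕ}

theorem finrank_inducedConjAlternating (n : ℕ) :
    Module.finrank ℂ (IndV (alternatingGroup (Fin n)).subtype
      (conjRep (alternatingGroup (Fin n)))) = n.factorial := by
  rw [finrank_indV, (MonoidAlgebra.coeffLinearEquiv ℂ).finrank_eq, Module.finrank_finsupp_self,
    ← Nat.card_eq_fintype_card, Subgroup.index_mul_card, Nat.card_eq_fintype_card,
    Fintype.card_perm, Fintype.card_fin]

theorem nonempty_inducedConjAlternating_equiv_omegaRep (n : ℕ) :
    Nonempty ((inducedConjAlternating n).Equiv (omegaRep (inducedConjAlternating n))) :=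
  ⟨(indEquivTwist sign (fun g ↦ g.2) _).trans (omegaRepEquiv _).symm⟩

theorem nonempty_inducedConjAlternating_equiv_prod (hn : 2 ≤ n) :
    Nonempty ((inducedConjAlternating n).Equiv
      ((conjRepOn (alternatingGroup (Fin n))).prod
        (omegaRep (conjRepOn (alternatingGroup (Fin n)))))) := by
  have : Nontrivial (Fin n) := Fin.nontrivial_iff_two_le.2 hn
  obtain ⟨x, y, hxy⟩ := exists_pair_ne (Fin n)
  rw [inducedConjAlternating, conjRep_eq_comp_subtype]
  let ρ := conjRepOn (alternatingGroup (Fin n))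
  let E : (ρ.prod (twistRep sign ρ)).Equiv (ρ.prod (omegaRep ρ)) :=
    Representation.Equiv.mk
      ((LinearEquiv.refl ℂ _).prodCongr (omegaRepEquiv ρ).symm.toLinearEquiv) fun σ ↦
        LinearMap.ext fun ⟨x, y⟩ ↦ Prod.ext rfl
          ((omegaRepEquiv ρ).symm.toIntertwiningMap.isIntertwining _ _ σ y)
  exact ⟨(indResEquivProd sign (sign_swap hxy) ρ).trans E⟩

theorem exists_injective_intertwiningMap (hn : n ≠ 3) {V : Type*} [AddCommGroup V] [Module ℂ V]
    (ρ : Representation ℂ (Perm (Fin n)) V) (hρ : ρ.IsIrreducible) :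
    ∃ f : ρ.IntertwiningMap (inducedConjAlternating n), Function.Injective f := by
  have : Nontrivial V := by
    by_contra hV
    rw [not_nontrivial_iff_subsingleton] at hV
    exact bot_ne_top (Subrepresentation.toSubmodule_injective (ρ := ρ) (Subsingleton.elim _ _))
  obtain ⟨g, hg, v, hv, hfix⟩ := exists_fixedByEvenCentralizer hn ρ (Fintype.card_fin n)
  obtain ⟨f, hf⟩ := exists_intertwiningMap_conjRep_ne_zero
    (ρ := ρ.comp (alternatingGroup (Fin n)).subtype) (g := ⟨g, hg⟩) hv fun s hs ↦
      hfix s s.2 (congr_arg Subtype.val hs)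
  obtain ⟨F, hF⟩ := exists_intertwiningMap_ind_ne_zero f hf
  exact ⟨F, (IsIrreducible.injective_or_eq_zero F).resolve_right hF⟩

end ConjugationRepresentations

section CycleTypePartitions

open Nat.Partition

variable {α : Type*} [Fintype α] [DecidableEq α]

theorem surjective_permPartition :
    Function.Surjective (Perm.partition : Perm α → (Fintype.card α).Partition) := by
  intro μ
  have hones : μ.parts.filter (¬ 2 ≤ ·) =
      Multiset.replicate (μ.parts.filter (¬ 2 ≤ ·)).card 1 :=
    Multiset.eq_replicate_card.2 fun i hi ↦ by
      have := μ.parts_pos (Multiset.mem_of_mem_filter hi)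
      have := Multiset.of_mem_filter hi
      lia
  have hsum : (μ.parts.filter (2 ≤ ·)).sum + (μ.parts.filter (¬ 2 ≤ ·)).card = Fintype.card α := by
    conv_rhs => rw [← μ.parts_sum, ← Multiset.filter_add_not (2 ≤ ·) μ.parts, Multiset.sum_add,
      hones, Multiset.sum_replicate, smul_eq_mul, mul_one]
  obtain ⟨σ, hσ⟩ := (exists_with_cycleType_iff α (m := μ.parts.filter (2 ≤ ·))).2
    ⟨Nat.le.intro hsum, fun a ha ↦ Multiset.of_mem_filter ha⟩
  refine ⟨σ, Nat.Partition.ext ?_⟩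
  rw [parts_partition, ← sum_cycleType, hσ, ← Nat.eq_sub_of_add_eq' hsum, ← hones,
    Multiset.filter_add_not]

theorem sign_eq_one_iff_even_partition (σ : Perm α) :
    sign σ = 1 ↔ Even (Fintype.card α - σ.partition.parts.card) := by
  have hle : σ.cycleType.card ≤ σ.cycleType.sum := by
    simpa using Multiset.card_nsmul_le_sum (a := 1) (s := σ.cycleType)
      fun x hx ↦ (one_lt_of_mem_cycleType hx).le
  have hsum : σ.cycleType.sum ≤ Fintype.card α := sum_cycleType_le σ
  have hcard : Fintype.card α - σ.partition.parts.card =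
      σ.cycleType.sum - σ.cycleType.card := by
    rw [parts_partition, ← sum_cycleType, Multiset.card_add, Multiset.card_replicate]
    lia
  rw [hcard, Nat.even_sub hle, ← Nat.even_add, sign_of_cycleType]
  exact neg_one_pow_eq_one_iff_even (by decide)

theorem centralizer_le_alternatingGroup_iff (σ : Perm α) :
    Subgroup.centralizer {σ} ≤ alternatingGroup α ↔
      σ.partition ∈ oddDistincts (Fintype.card α) := by
  have hcount (i : ℕ) : σ.partition.parts.count i =
      σ.cycleType.count i + if i = 1 then Fintype.card α - σ.cycleType.sum else 0 := by
    rw [parts_partition, ← sum_cycleType, Multiset.count_add, Multiset.count_replicate]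
    simp only [eq_comm]
  have hcount_one : σ.cycleType.count 1 = 0 :=
    Multiset.count_eq_zero.2 fun h ↦ (one_lt_of_mem_cycleType h).false
  have hodd : (∀ i ∈ σ.partition.parts, ¬ Even i) ↔ ∀ i ∈ σ.cycleType, Odd i := by
    simp only [parts_partition, Multiset.mem_add, or_imp, forall_and, Nat.not_even_iff_odd,
      and_iff_left_iff_imp]
    rintro - i hi
    simp [Multiset.eq_of_mem_replicate hi]
  rw [centralizer_le_alternating_iff, oddDistincts, mem_inter, odds, restricted, distincts,
    mem_filter_univ, mem_filter_univ, Multiset.nodup_iff_count_le_one, hodd]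
  refine and_congr_right fun _ ↦ ⟨fun h i ↦ ?_, fun h ↦ ⟨?_, fun i ↦ ?_⟩⟩
  · rw [hcount]
    split_ifs with hi
    · subst hi
      have := h.1
      lia
    · exact h.2 i
  · have := h 1
    rw [hcount, hcount_one, if_pos rfl] at this
    lia
  · exact le_of_add_le_left ((hcount i).symm.trans_le (h i))

theorem even_of_mem_oddDistincts {n : ℕ} {μ : n.Partition} (hμ : μ ∈ oddDistincts n) :
    Even (n - μ.parts.card) := by
  have key : ∀ μ ∈ oddDistincts (Fintype.card (Fin n)),
      Even (Fintype.card (Fin n) - μ.parts.card) := fun μ hμ ↦ by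
    obtain ⟨σ, rfl⟩ := surjective_permPartition μ
    rw [← sign_eq_one_iff_even_partition, ← mem_alternatingGroup]
    exact (centralizer_le_alternatingGroup_iff σ).2 hμ
      (Subgroup.mem_centralizer_singleton_iff.2 rfl)
  rw [Fintype.card_fin] at key
  exact key μ hμ

theorem sum_card_centralizer_smul {M : Type*} [AddCommMonoid M]
    (F : (Fintype.card α).Partition → M) :
    ∑ σ : Perm α, Nat.card (Subgroup.centralizer {σ}) • F σ.partition =
      (Fintype.card α).factorial • ∑ μ, F μ := by
  rw [← sum_fiberwise _ Perm.partition, smul_sum]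
  refine sum_congr rfl fun μ _ ↦ ?_
  obtain ⟨σ, rfl⟩ := surjective_permPartition μ
  have hconst (τ) (hτ : τ ∈ ({τ | τ.partition = σ.partition} : Finset (Perm α))) :
      Nat.card (Subgroup.centralizer {τ}) • F τ.partition =
        Nat.card (Subgroup.centralizer {σ}) • F σ.partition := by
    rw [mem_filter_univ] at hτ
    rw [nat_card_centralizer, nat_card_centralizer, hτ,
      (isConj_iff_cycleType_eq.1 (partition_eq_of_isConj.2 hτ))]
  have hclass : #{τ : Perm α | τ.partition = σ.partition} = Nat.card {τ | IsConj σ τ} := by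
    rw [← Set.ncard_coe_finset, ← Nat.card_coe_set_eq]
    simp only [coe_filter, mem_univ, true_and, partition_eq_of_isConj, eq_comm]
  rw [sum_congr rfl hconst, sum_const, smul_smul, hclass, nat_card_centralizer, card_isConj_mul_eq]

end CycleTypePartitions

section Character

open Representation

theorem two_mul_card_subgroupOf {G : Type*} [Group G] {H : Subgroup G} (hH : H.index = 2)
    (K : Subgroup G) [Decidable (K ≤ H)] :
    2 * Nat.card (H.subgroupOf K) = (if K ≤ H then 2 else 1) * Nat.card K := by
  have := Subgroup.normal_of_index_eq_two hH
  have hcard : Nat.card (H.subgroupOf K) * H.relIndex K = Nat.card K :=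
    Subgroup.card_mul_index _
  rw [← hcard]
  split_ifs with hK
  · rw [Subgroup.relIndex_eq_one.2 hK, mul_one]
  · have : H.relIndex K = 2 := ((Nat.dvd_prime Nat.prime_two).1
      (hH ▸ H.relIndex_dvd_index_of_normal K)).resolve_left (mt Subgroup.relIndex_eq_one.1 hK)
    rw [this, one_mul, mul_comm]

theorem two_mul_character_conjRepOn {G : Type*} [Group G] [Finite G] {H : Subgroup G} [H.Normal]
    (hH : H.index = 2) (g : G) [Decidable (Subgroup.centralizer {g} ≤ H)] :
    2 * (conjRepOn H).character g =
      (if Subgroup.centralizer {g} ≤ H then 2 else 1 : ℂ) *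
        Nat.card (Subgroup.centralizer {g}) := by
  have hcard : Nat.card {x : H // Commute (x : G) g} =
      Nat.card (H.subgroupOf (Subgroup.centralizer {g})) :=
    Nat.card_congr
      { toFun x := ⟨⟨x.1, Subgroup.mem_centralizer_singleton_iff.2 x.2⟩, x.1.2⟩
        invFun x := ⟨⟨x.1, x.2⟩, Subgroup.mem_centralizer_singleton_iff.1 x.1.2⟩ }
  rw [character_conjRepOn, hcard]
  exact_mod_cast two_mul_card_subgroupOf hH (Subgroup.centralizer {g})

theorem character_omegaRep {n : ℕ} {V : Type*} [AddCommGroup V] [Module ℂ V]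
    [FiniteDimensional ℂ V] (ρ : Representation ℂ (Perm (Fin n)) V) (σ : Perm (Fin n)) :
    (omegaRep ρ).character σ = ((sign σ : ℤ) : ℂ) * ρ.character σ := by
  rw [omegaRep, char_tensor, Pi.mul_apply]
  simp [signRep, character]

theorem character_inducedConjAlternating {n : ℕ} (hn : 2 ≤ n) (σ : Perm (Fin n)) :
    (inducedConjAlternating n).character σ =
      (if Even (Fintype.card (Fin n) - σ.partition.parts.card) then
        if σ.partition ∈ Nat.Partition.oddDistincts _ then 2 else 1 else 0 : ℂ) *
          Nat.card (Subgroup.centralizer {σ}) := by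
  classical
  have : Nontrivial (Fin n) := Fin.nontrivial_iff_two_le.2 hn
  have : FiniteDimensional ℂ (MonoidAlgebra ℂ (alternatingGroup (Fin n))) :=
    Module.Finite.equiv (MonoidAlgebra.coeffLinearEquiv ℂ).symm
  obtain ⟨e⟩ := nonempty_inducedConjAlternating_equiv_prod hn
  have hchar : (inducedConjAlternating n).character σ =
      (1 + ((sign σ : ℤ) : ℂ)) * (conjRepOn (alternatingGroup (Fin n))).character σ := by
    rw [char_iso e, add_mul, one_mul, ← character_omegaRep]
    exact LinearMap.trace_prodMap' _ _
  simp only [hchar, ← sign_eq_one_iff_even_partition, ← centralizer_le_alternatingGroup_iff]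
  rcases Int.units_eq_one_or (sign σ) with hσ | hσ
  · rw [if_pos hσ, ← two_mul_character_conjRepOn alternatingGroup.index_eq_two, hσ]
    norm_num
  · simp [hσ]

theorem ch_eq_sum_smul_pPart {n : ℕ} {V : Type*} [AddCommGroup V] [Module ℂ V]
    {ρ : Representation ℂ (Perm (Fin n)) V} (c : ∀ m : ℕ, m.Partition → ℂ)
    (hρ : ∀ σ, ρ.character σ = c _ σ.partition * Nat.card (Subgroup.centralizer {σ})) :
    SymmFun.ch ρ = ∑ μ : n.Partition, c n μ • SymmFun.pPart μ := by
  have hsum (m : ℕ) (hm : Fintype.card (Fin n) = m) :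
      ∑ σ, ρ.character σ • SymmFun.pPart σ.partition =
        (m.factorial : ℂ) • ∑ μ : m.Partition, c m μ • SymmFun.pPart μ := by
    subst hm
    rw [Nat.cast_smul_eq_nsmul, ← sum_card_centralizer_smul]
    refine sum_congr rfl fun σ _ ↦ ?_
    rw [hρ, mul_comm, mul_smul, Nat.cast_smul_eq_nsmul]
  rw [SymmFun.ch, hsum n (Fintype.card_fin n),
    inv_smul_smul₀ (Nat.cast_ne_zero.2 n.factorial_ne_zero)]

theorem ch_inducedConjAlternating {n : ℕ} (hn : 2 ≤ n) :
    SymmFun.ch (inducedConjAlternating n) =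
      2 * ∑ μ ∈ Nat.Partition.oddDistincts n, SymmFun.pPart μ +
        ∑ μ : n.Partition with
          μ ∉ Nat.Partition.oddDistincts n ∧ Even (n - Multiset.card μ.parts),
          SymmFun.pPart μ := by
  rw [ch_eq_sum_smul_pPart
      (fun m μ ↦ if Even (m - μ.parts.card) then
        if μ ∈ Nat.Partition.oddDistincts m then 2 else 1 else 0)
      (character_inducedConjAlternating hn),
    ← filter_univ_mem (Nat.Partition.oddDistincts n), mul_sum, sum_filter, sum_filter,
    ← sum_add_distrib]
  refine sum_congr rfl fun μ _ ↦ ?_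
  by_cases hμ : μ ∈ Nat.Partition.oddDistincts n
  · simp [hμ, even_of_mem_oddDistincts hμ, two_smul, two_mul]
  · simp [hμ]

end Character

section FrobeniusCharacteristicThree

open MvPowerSeries

theorem even_three_sub_card_parts_iff (μ : Nat.Partition 3) :
    Even (3 - μ.parts.card) ↔ μ.parts = {3} ∨ μ.parts = {1, 1, 1} := by
  refine ⟨fun heven ↦ ?_, by rintro (h | h) <;> simp [h]⟩
  have hpos : 0 < μ.parts.card := Multiset.card_pos.2 fun h ↦ by simpa [h] using μ.parts_sum
  have hle : μ.parts.card ≤ 3 := by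
    simpa [μ.parts_sum] using Multiset.card_nsmul_le_sum (a := 1) fun _ h ↦ μ.parts_pos h
  have hcard : μ.parts.card = 1 ∨ μ.parts.card = 3 := by
    have := Nat.even_iff.1 heven
    lia
  rcases hcard with hcard | hcard
  · obtain ⟨a, ha⟩ := Multiset.card_eq_one.1 hcard
    left
    simpa [ha] using μ.parts_sum
  · obtain ⟨a, b, c, habc⟩ := Multiset.card_eq_three.1 hcard
    have hsum := μ.parts_sum
    have hone : ∀ i ∈ μ.parts, 1 ≤ i := fun _ h ↦ μ.parts_pos h
    simp only [habc, Multiset.insert_eq_cons, Multiset.sum_cons, Multiset.sum_singleton,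
      Multiset.mem_cons, Multiset.mem_singleton, forall_eq_or_imp, forall_eq] at hsum hone
    obtain ⟨rfl, rfl, rfl⟩ : a = 1 ∧ b = 1 ∧ c = 1 := by lia
    exact .inr habc

theorem mem_oddDistincts_three_iff (μ : Nat.Partition 3) :
    μ ∈ Nat.Partition.oddDistincts 3 ↔ μ.parts = {3} := by
  refine ⟨fun hμ ↦ ?_, fun hμ ↦ ?_⟩
  · refine ((even_three_sub_card_parts_iff μ).1 (even_of_mem_oddDistincts hμ)).resolve_right ?_
    have hnodup := (mem_filter.1 (mem_inter.1 hμ).2).2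
    intro h
    simp [h] at hnodup
  · simp [Nat.Partition.oddDistincts, Nat.Partition.odds, Nat.Partition.restricted,
      Nat.Partition.distincts, hμ, show Odd 3 by decide]

namespace SymmFun

theorem coeff_p (k : ℕ) (m : ℕ →₀ ℕ) [Decidable (∃ i, m = Finsupp.single i k)] :
    coeff m (p k) = if ∃ i, m = Finsupp.single i k then 1 else 0 := by
  rw [coeff_apply, p]
  congr

theorem coeff_h (k : ℕ) (m : ℕ →₀ ℕ) : coeff m (h k) = if m.degree = k then 1 else 0 := rfl

theorem coeff_e (k : ℕ) (m : ℕ →₀ ℕ) [Decidable (m.degree = k ∧ ∀ i, m i ≤ 1)] :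
    coeff m (e k) = if m.degree = k ∧ ∀ i, m i ≤ 1 then 1 else 0 := by
  rw [coeff_apply, e]
  congr

theorem coeff_p_one_mul (m : ℕ →₀ ℕ) (f : MvPowerSeries ℕ ℂ) :
    coeff m (p 1 * f) = ∑ i ∈ m.support, coeff (m - Finsupp.single i 1) f := by
  classical
  simp_rw [coeff_mul, coeff_p, ite_mul, one_mul, zero_mul]
  rw [← sum_filter]
  refine (sum_bij (fun i _ ↦ (Finsupp.single i 1, m - Finsupp.single i 1)) (fun i hi ↦ ?_)
    (fun i _ j _ hij ↦ ?_) ?_ fun _ _ ↦ rfl).symm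
  · have hle : Finsupp.single i 1 ≤ m := by
      simpa [Nat.one_le_iff_ne_zero] using hi
    exact mem_filter.2 ⟨mem_antidiagonal.2 (add_tsub_cancel_of_le hle), i, rfl⟩
  · simpa [Finsupp.single_left_inj] using congrArg Prod.fst hij
  · rintro ⟨_, b⟩ hb
    obtain ⟨hadd, i, rfl⟩ := mem_filter.1 hb
    obtain rfl := mem_antidiagonal.1 hadd
    exact ⟨i, by simp, by simp⟩

theorem prod_factorial_eq_mul {m : ℕ →₀ ℕ} {i : ℕ} (hi : i ∈ m.support) :
    m.prod (fun _ a ↦ a.factorial) =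
      m i * (m - Finsupp.single i 1).prod fun _ a ↦ a.factorial := by
  have hne : m i ≠ 0 := Finsupp.mem_support_iff.1 hi
  have herase : (m - Finsupp.single i 1).erase i = m.erase i := by
    ext j
    rcases eq_or_ne j i with rfl | hj
    · simp
    · simp [hj]
  rw [← Finsupp.mul_prod_erase' m i _ (by simp),
    ← Finsupp.mul_prod_erase' (m - Finsupp.single i 1) i _ (by simp), herase, ← mul_assoc]
  simp [Nat.mul_factorial_pred hne]

theorem coeff_p_one_pow (k : ℕ) (m : ℕ →₀ ℕ) :
    m.prod (fun _ a ↦ a.factorial) * coeff m (p 1 ^ k) =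
      if m.degree = k then (k.factorial : ℂ) else 0 := by
  classical
  induction k generalizing m with
  | zero => by_cases hm : m = 0 <;> simp [coeff_one, hm, Finsupp.degree_eq_zero_iff]
  | succ k ih =>
    have hterm (i) (hi : i ∈ m.support) :
        m.prod (fun _ a ↦ a.factorial) * coeff (m - Finsupp.single i 1) (p 1 ^ k) =
          m i * if m.degree = k + 1 then (k.factorial : ℂ) else 0 := by
      have hdeg : (m - Finsupp.single i 1).degree = k ↔ m.degree = k + 1 := by
        have hle : Finsupp.single i 1 ≤ m := by simpa [Nat.one_le_iff_ne_zero] using hi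
        conv_rhs => rw [← tsub_add_cancel_of_le hle, map_add, Finsupp.degree_single]
        lia
      rw [prod_factorial_eq_mul hi, Nat.cast_mul, mul_assoc, ih]
      simp only [hdeg]
    rw [pow_succ', coeff_p_one_mul, mul_sum, sum_congr rfl hterm, ← sum_mul, ← Nat.cast_sum,
      ← Finsupp.degree_apply]
    split_ifs with hm
    · rw [hm, Nat.factorial_succ, Nat.cast_mul]
    · rw [mul_zero]

theorem prod_factorial_eq_of_le_one {m : ℕ →₀ ℕ} {i : ℕ} (hm : ∀ j ≠ i, m j ≤ 1) :
    m.prod (fun _ a ↦ a.factorial) = (m i).factorial := by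
  rw [← Finsupp.mul_prod_erase' m i _ (by simp), Finsupp.prod, prod_eq_one, mul_one]
  intro j hj
  rw [Finsupp.support_erase, mem_erase] at hj
  rw [Finsupp.erase_ne hj.1, Nat.factorial_eq_one]
  exact hm j hj.1

theorem degree_erase_add (m : ℕ →₀ ℕ) (i : ℕ) : (m.erase i).degree + m i = m.degree := by
  conv_rhs => rw [← Finsupp.erase_add_single i m, map_add, Finsupp.degree_single]

theorem exists_forall_ne_le_one {m : ℕ →₀ ℕ} (hm : m.degree = 3) : ∃ i, ∀ j ≠ i, m j ≤ 1 := by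
  by_cases h : ∀ j, m j ≤ 1
  · exact ⟨0, fun j _ ↦ h j⟩
  · push Not at h
    obtain ⟨i, hi⟩ := h
    refine ⟨i, fun j hj ↦ ?_⟩
    have := degree_erase_add m i
    have := (Finsupp.erase_ne hj (f := m)) ▸ Finsupp.le_degree j (m.erase i)
    lia

theorem eq_single_iff_of_degree_eq {m : ℕ →₀ ℕ} {k : ℕ} (hm : m.degree = k) (i : ℕ) :
    m = Finsupp.single i k ↔ m i = k := by
  refine ⟨fun h ↦ by rw [h, Finsupp.single_eq_same], fun h ↦ ?_⟩
  have herase : m.erase i = 0 := by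
    rw [← Finsupp.degree_eq_zero_iff]
    have := degree_erase_add m i
    lia
  rw [← Finsupp.erase_add_single i m, herase, zero_add, h]

theorem coeff_p_three_add_coeff_p_one_pow_three {m : ℕ →₀ ℕ} (hm : m.degree = 3) :
    2 * coeff m (p 3) + coeff m (p 1 ^ 3) = 3 * (coeff m (h 3) + coeff m (e 3)) := by
  classical
  obtain ⟨i, hi⟩ := exists_forall_ne_le_one hm
  have hle : m i ≤ 3 := hm ▸ m.le_degree i
  have hpow := coeff_p_one_pow 3 m
  rw [prod_factorial_eq_of_le_one hi, if_pos hm] at hpow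
  have hsingle : (∃ a, m = Finsupp.single a 3) ↔ m i = 3 := by
    simp only [eq_single_iff_of_degree_eq hm]
    refine ⟨fun ⟨a, ha⟩ ↦ ?_, fun h ↦ ⟨i, h⟩⟩
    have hai : a = i := by
      by_contra hai
      have := hi a hai
      lia
    exact hai ▸ ha
  have hsquarefree : (∀ j, m j ≤ 1) ↔ m i ≤ 1 :=
    ⟨fun h ↦ h i, fun h j ↦ (eq_or_ne j i).elim (fun hj ↦ hj ▸ h) (hi j)⟩
  simp only [coeff_p, coeff_h, coeff_e, hsingle, hsquarefree, hm, true_and, if_true]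
  generalize coeff m (p 1 ^ 3) = c at hpow ⊢
  generalize m i = a at hle hpow ⊢
  interval_cases a <;> norm_num [Nat.factorial] at hpow ⊢ <;> grind

theorem two_mul_p_three_add_p_one_pow_three : 2 * p 3 + p 1 ^ 3 = 3 * (h 3 + e 3) := by
  classical
  ext m
  have hcoeff (k : ℕ) (f : MvPowerSeries ℕ ℂ) :
      coeff m ((k : MvPowerSeries ℕ ℂ) * f) = k * coeff m f := by
    rw [← nsmul_eq_mul, map_nsmul, nsmul_eq_mul]
  have htwo : coeff m (2 * p 3) = 2 * coeff m (p 3) := hcoeff 2 _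
  have hthree : coeff m (3 * (h 3 + e 3)) = 3 * coeff m (h 3 + e 3) := hcoeff 3 _
  rw [map_add, htwo, hthree, map_add]
  by_cases hm : m.degree = 3
  · exact coeff_p_three_add_coeff_p_one_pow_three hm
  · have hpow : coeff m (p 1 ^ 3) = 0 := by
      have hprod : ((m.prod fun _ a ↦ a.factorial : ℕ) : ℂ) ≠ 0 :=
        Nat.cast_ne_zero.2 (prod_ne_zero_iff.2 fun i _ ↦ (m i).factorial_ne_zero)
      exact (mul_eq_zero.1 ((coeff_p_one_pow 3 m).trans (if_neg hm))).resolve_left hprod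
    have hsingle : ¬ ∃ a, m = Finsupp.single a 3 := by
      rintro ⟨a, rfl⟩
      exact hm (Finsupp.degree_single a 3)
    simp [coeff_p, coeff_h, coeff_e, hm, hpow, hsingle]

theorem ch_inducedConjAlternating_three :
    ch (inducedConjAlternating 3) = 3 * (h 3 + e 3) := by
  have hdistinct : Nat.Partition.oddDistincts 3 = {⟨{3}, by simp, by simp⟩} := by
    ext μ
    rw [mem_oddDistincts_three_iff, mem_singleton, Nat.Partition.ext_iff]
  have heven : ({μ | μ ∉ Nat.Partition.oddDistincts 3 ∧ Even (3 - μ.parts.card)} :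
      Finset (Nat.Partition 3)) = {⟨{1, 1, 1}, by simp, by simp⟩} := by
    ext μ
    rw [mem_filter_univ, mem_oddDistincts_three_iff, even_three_sub_card_parts_iff, mem_singleton,
      Nat.Partition.ext_iff]
    refine ⟨fun h ↦ h.2.resolve_left h.1, fun h ↦ ⟨?_, .inr h⟩⟩
    rw [h]
    decide
  rw [ch_inducedConjAlternating (by norm_num), heven, hdistinct, sum_singleton, sum_singleton,
    ← two_mul_p_three_add_p_one_pow_three]
  simp [pPart, pow_three]

end SymmFun

end FrobeniusCharacteristicThree

theorem theorem6p4 (n : ℕ) :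
    -- self-conjugate
    Nonempty ((inducedConjAlternating n).Equiv (omegaRep (inducedConjAlternating n))) ∧
    -- of degree n!
    Module.finrank ℂ (Representation.IndV (alternatingGroup (Fin n)).subtype
      (conjRep (alternatingGroup (Fin n)))) = n.factorial ∧
    -- Frobenius characteristic
    (2 ≤ n →
      SymmFun.ch (inducedConjAlternating n) =
        2 * ∑ μ ∈ Nat.Partition.oddDistincts n, SymmFun.pPart μ +
          ∑ μ : n.Partition with
            μ ∉ Nat.Partition.oddDistincts n ∧ Even (n - Multiset.card μ.parts),
            SymmFun.pPart μ) ∧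
    -- decomposition into the conjugation action on the even permutations and its sign twist
    (2 ≤ n →
      Nonempty ((inducedConjAlternating n).Equiv
        ((conjRepOn (alternatingGroup (Fin n))).prod
          (omegaRep (conjRepOn (alternatingGroup (Fin n))))))) ∧
    -- every irreducible representation of the symmetric group occurs
    (n ≠ 3 →
      ∀ (V : Type*) [AddCommGroup V] [Module ℂ V]
        (ρ : Representation ℂ (Equiv.Perm (Fin n)) V), ρ.IsIrreducible →
        ∃ f : ρ.IntertwiningMap (inducedConjAlternating n), Function.Injective f) ∧
    -- the exceptional case
    (n = 3 →
      SymmFun.ch (inducedConjAlternating n) = 3 * (SymmFun.h 3 + SymmFun.e 3)) :=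
  ⟨nonempty_inducedConjAlternating_equiv_omegaRep n, finrank_inducedConjAlternating n,
    ch_inducedConjAlternating, nonempty_inducedConjAlternating_equiv_prod,
    fun hn _ _ _ ρ hρ ↦ exists_injective_intertwiningMap hn ρ hρ,
    by rintro rfl; exact SymmFun.ch_inducedConjAlternating_three⟩
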